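/- Setting. Let $N\ge 1$, let $\mathcal H_1,\dots,\mathcal H_N$ be complex separable Hilbert spaces (of any dimension), and let $\rho$ be a state on the Hilbert space tensor product $\mathcal H_1\otimes\cdots\otimes\mathcal H_N$, that is, a positive trace class operator with $\mathrm{tr}\,\rho=1$. All numbers of settings $S_1,\dots,S_N$ are positive integers. Source operators. An $S_1\times\cdots\times S_N$-setting source operator for $\rho$ is a self-adjoint trace class operator $T$ on $\mathcal H_1^{\otimes S_1}\otimes\cdots\otimes\mathcal H_N^{\otimes S_N}$ such that, for every choice of one copy $k_n\in\{1,\dots,S_n\}$ of $\mathcal H_n$ at each site $n$ and all bounded linear operators $X_n$ on $\mathcal H_n$, one has $\mathrm{tr}[T\,\widehat X]=\mathrm{tr}[\rho\,(X_1\otimes\cdots\otimes X_N)]$, where $\widehat X$ is the tensor product operator acting as $X_n$ on the $k_n$-th copy of $\mathcal H_n$, for each $n$, and as the identity on all other copies. A bounded operator $Z$ on $\mathcal G_1\otimes\cdots\otimes\mathcal G_m$ is tensor positive if $(\psi_1\otimes\cdots\otimes\psi_m,\,Z\,\psi_1\otimes\cdots\otimes\psi_m)\ge 0$ for all $\psi_j\in\mathcal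 G_j$; for a source operator this refers to all $m=S_1+\cdots+S_N$ tensor factors. LHV description. The state $\rho$ admits the $S_1\times\cdots\times S_N$-setting LHV description if, for all standard measurable spaces $(\Lambda_n,\mathcal F_n)$ and all normalized positive operator-valued measures $\mathrm M_n^{(s)}$ on $\Lambda_n$ with values in the bounded operators on $\mathcal H_n$ ($s=1,\dots,S_n$, $n=1,\dots,N$), there exist a probability space $(\Omega,\nu)$ and conditional probability measures $P_n^{(s)}(\cdot\,|\,\omega)$ on $\Lambda_n$, with $\omega\mapsto P_n^{(s)}(F\,|\,\omega)$ measurable for each $F\in\mathcal F_n$, such that $$\mathrm{tr}\big[\rho\,\{\mathrm M_1^{(s_1)}(F_1)\otimes\cdots\otimes \mathrm M_N^{(s_N)}(F_N)\}\big]=\int_\Omega P_1^{(s_1)}(F_1|\omega)\cdots P_N^{(s_N)}(F_N|\omega)\,\nu(\mathrm d\omega)$$ for all $s_n\in\{1,\dots,S_n\}$ and all $F_n\in\mathcal F_n$. Proposition 5. (a) Every state $\rho$ admits the $1\times\cdots\times1\times S_n\times1\times\cdots\times1$-setting LHV description, for every site $n$ and every $S_n\ge1$. (b) If, for some site $n$,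 $\rho$ has a tensor positive $S_1\times\cdots\times S_N$-setting source operator with $S_n=1$, then $\rho$ admits the $S_1\times\cdots\times\widetilde S_n\times\cdots\times S_N$-setting LHV description for every number $\widetilde S_n\ge1$ of settings at this site $n$. (c) If $\rho$ has a tensor positive $S_1\times\cdots\times S_N$-setting source operator, then, for each site $n$ and every $S_n'\ge1$, $\rho$ admits the $S_1\times\cdots\times S_n'\times\cdots\times S_N$-setting LHV description (only the number of settings at this one site $n$ being changed). -/

import Mathlib

open MeasureTheory ProbabilityTheory
open scoped TensorProduct InnerProductSpace ComplexConjugate ComplexOrder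

universe u v

noncomputable section

namespace HilbertTensor

/-! ### The Hilbert space tensor product of a finite family of Hilbert spaces -/

section Construction

variable {ι : Type*} [Fintype ι] {G : ι → Type*}
  [∀ i, NormedAddCommGroup (G i)] [∀ i, InnerProductSpace ℂ (G i)]

/-- For fixed `x`, the linear functional on the algebraic tensor product with
`⊗ y ↦ ∏ i, ⟪x i, y i⟫`. -/
def innerTprod (x : ∀ i, G i) : (⨂[ℂ] i, G i) →ₗ[ℂ] ℂ :=
  PiTensorProduct.lift
    ((MultilinearMap.mkPiAlgebra ℂ ι ℂ).compLinearMap fun i => innerₛₗ ℂ (x i))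

@[simp]
theorem innerTprod_tprod (x y : ∀ i, G i) :
    innerTprod x (PiTensorProduct.tprod ℂ y) = ∏ i, ⟪x i, y i⟫_ℂ := by
  simp [innerTprod]

theorem innerTprod_update_add [DecidableEq ι] (x : ∀ i, G i) (i : ι) (a b : G i) :
    innerTprod (Function.update x i (a + b)) =
      innerTprod (Function.update x i a) + innerTprod (Function.update x i b) := by
  refine PiTensorProduct.ext (MultilinearMap.ext fun y => ?_)
  simp only [LinearMap.compMultilinearMap_apply, innerTprod_tprod, LinearMap.add_apply]
  have h : ∀ c : G i, ∏ j, ⟪Function.update x i c j, y j⟫_ℂ =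
      ⟪c, y i⟫_ℂ * ∏ j ∈ Finset.univ.erase i, ⟪x j, y j⟫_ℂ := by
    intro c
    rw [← Finset.mul_prod_erase Finset.univ _ (Finset.mem_univ i)]
    congr 1
    · simp
    · refine Finset.prod_congr rfl fun j hj => ?_
      rw [Function.update_of_ne (Finset.ne_of_mem_erase hj)]
  rw [h, h, h, inner_add_left, add_mul]

theorem innerTprod_update_smul [DecidableEq ι] (x : ∀ i, G i) (i : ι) (r : ℂ) (a : G i) :
    innerTprod (Function.update x i (r • a)) =
      conj r • innerTprod (Function.update x i a) := by
  refine PiTensorProduct.ext (MultilinearMap.ext fun y => ?_)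
  simp only [LinearMap.compMultilinearMap_apply, innerTprod_tprod, LinearMap.smul_apply]
  have h : ∀ c : G i, ∏ j, ⟪Function.update x i c j, y j⟫_ℂ =
      ⟪c, y i⟫_ℂ * ∏ j ∈ Finset.univ.erase i, ⟪x j, y j⟫_ℂ := by
    intro c
    rw [← Finset.mul_prod_erase Finset.univ _ (Finset.mem_univ i)]
    congr 1
    · simp
    · refine Finset.prod_congr rfl fun j hj => ?_
      rw [Function.update_of_ne (Finset.ne_of_mem_erase hj)]
  rw [h, h, inner_smul_left, smul_eq_mul, mul_assoc]

/-- For fixed `t`, the linear functional on the algebraic tensor product whose complex conjugate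
is `s ↦ ⟪s, t⟫`. -/
def conjInner (t : ⨂[ℂ] i, G i) : (⨂[ℂ] i, G i) →ₗ[ℂ] ℂ :=
  PiTensorProduct.lift
    { toFun := fun x => conj (innerTprod x t)
      map_update_add' := fun x i a b => by simp [innerTprod_update_add]
      map_update_smul' := fun x i r a => by simp [innerTprod_update_smul] }

@[simp]
theorem conjInner_tprod (t : ⨂[ℂ] i, G i) (x : ∀ i, G i) :
    conjInner t (PiTensorProduct.tprod ℂ x) = conj (innerTprod x t) := by
  simp [conjInner]

theorem conjInner_add (t t' : ⨂[ℂ] i, G i) : conjInner (t + t') = conjInner t + conjInner t' :=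
  PiTensorProduct.ext (MultilinearMap.ext fun x => by simp)

theorem conjInner_smul (r : ℂ) (t : ⨂[ℂ] i, G i) : conjInner (r • t) = conj r • conjInner t :=
  PiTensorProduct.ext (MultilinearMap.ext fun x => by simp)

theorem conjInner_symm (s t : ⨂[ℂ] i, G i) : conj (conjInner t s) = conjInner s t := by
  induction s using PiTensorProduct.induction_on with
  | add a b ha hb => rw [map_add, map_add, ha, hb, conjInner_add, LinearMap.add_apply]
  | smul_tprod r x =>
    induction t using PiTensorProduct.induction_on with
    | add a b ha hb =>
      rw [conjInner_add, LinearMap.add_apply, map_add, map_add, ha, hb]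
    | smul_tprod r' y =>
      simp only [conjInner_smul, LinearMap.smul_apply, map_smul, conjInner_tprod,
        innerTprod_tprod, smul_eq_mul, map_mul, map_prod, Complex.conj_conj, inner_conj_symm]
      ring

end Construction

section Positivity

variable {α : Type*} {E : Type*} [NormedAddCommGroup E] [InnerProductSpace ℂ E]

theorem gram_sum_eq (f : α → E) (c : α →₀ ℂ) :
    (c.sum fun i a => c.sum fun j b => star a * ⟪f i, f j⟫_ℂ * b) =
      ⟪c.sum fun i a => a • f i, c.sum fun i a => a • f i⟫_ℂ := by
  simp only [Finsupp.sum, sum_inner, inner_sum, inner_smul_left, inner_smul_right, starRingEnd_apply,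
    Finset.mul_sum]
  rw [Finset.sum_comm]
  exact Finset.sum_congr rfl fun i _ => Finset.sum_congr rfl fun j _ => by ring

theorem inner_self_eq_ofReal (x : E) : ⟪x, x⟫_ℂ = ((‖x‖ ^ 2 : ℝ) : ℂ) := by
  rw [inner_self_eq_norm_sq_to_K]
  push_cast
  rfl

theorem posSemidef_inner (f : α → E) :
    (Matrix.of fun x y => ⟪f x, f y⟫_ℂ).PosSemidef := by
  refine ⟨Matrix.IsHermitian.ext fun i j => by simp, fun c => ?_⟩
  simp only [Matrix.of_apply]
  rw [gram_sum_eq, inner_self_eq_ofReal]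
  exact Complex.zero_le_real.mpr (sq_nonneg _)

theorem posSemidef_inner_sub (A : E →L[ℂ] E) (f : α → E) :
    (Matrix.of fun x y => (‖A‖ : ℂ) ^ 2 * ⟪f x, f y⟫_ℂ - ⟪A (f x), A (f y)⟫_ℂ).PosSemidef := by
  refine ⟨Matrix.IsHermitian.ext fun i j => by simp, fun c => ?_⟩
  have h : (c.sum fun i a => c.sum fun j b =>
      star a * ((‖A‖ : ℂ) ^ 2 * ⟪f i, f j⟫_ℂ - ⟪A (f i), A (f j)⟫_ℂ) * b) =
      (‖A‖ : ℂ) ^ 2 * (c.sum fun i a => c.sum fun j b => star a * ⟪f i, f j⟫_ℂ * b) -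
        c.sum fun i a => c.sum fun j b => star a * ⟪A (f i), A (f j)⟫_ℂ * b := by
    simp only [Finsupp.sum, Finset.mul_sum, ← Finset.sum_sub_distrib]
    exact Finset.sum_congr rfl fun i _ => Finset.sum_congr rfl fun j _ => by ring
  simp only [Matrix.of_apply]
  rw [h, gram_sum_eq, gram_sum_eq (fun i => A (f i))]
  have h2 : (c.sum fun i a => a • A (f i)) = A (c.sum fun i a => a • f i) := by
    simp [Finsupp.sum]
  rw [h2, inner_self_eq_ofReal, inner_self_eq_ofReal, sub_nonneg]
  have h3 := A.le_opNorm (c.sum fun i a => a • f i)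
  have h4 : ‖A (c.sum fun i a => a • f i)‖ ^ 2 ≤ ‖A‖ ^ 2 * ‖c.sum fun i a => a • f i‖ ^ 2 := by
    rw [← mul_pow]
    exact pow_le_pow_left₀ (norm_nonneg _) h3 2
  exact_mod_cast h4

variable {ι : Type*} {G : ι → Type*}
  [∀ i, NormedAddCommGroup (G i)] [∀ i, InnerProductSpace ℂ (G i)]

theorem posSemidef_prod (s : Finset ι) :
    (Matrix.of fun x y : ∀ i, G i => ∏ i ∈ s, ⟪x i, y i⟫_ℂ).PosSemidef := by
  classical
  induction s using Finset.induction_on with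
  | empty =>
    have h := posSemidef_inner (E := ℂ) (fun _ : ∀ i, G i => (1 : ℂ))
    simpa using h
  | insert i s hi ih =>
    have h := (posSemidef_inner (fun x : ∀ i, G i => x i)).hadamard ih
    have e : (Matrix.of fun x y : ∀ i, G i => ∏ j ∈ insert i s, ⟪x j, y j⟫_ℂ) =
        (Matrix.of fun x y : ∀ i, G i => ⟪x i, y i⟫_ℂ).hadamard
          (Matrix.of fun x y : ∀ i, G i => ∏ j ∈ s, ⟪x j, y j⟫_ℂ) := by
      ext x y
      simp [Finset.prod_insert hi, Matrix.hadamard_apply]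
    rw [e]
    exact h

theorem posSemidef_prod_sub (A : ∀ i, G i →L[ℂ] G i) (s : Finset ι) :
    (Matrix.of fun x y : ∀ i, G i =>
      (∏ i ∈ s, (‖A i‖ : ℂ) ^ 2) * ∏ i ∈ s, ⟪x i, y i⟫_ℂ -
        ∏ i ∈ s, ⟪A i (x i), A i (y i)⟫_ℂ).PosSemidef := by
  classical
  induction s using Finset.induction_on with
  | empty =>
    have h := posSemidef_inner (E := ℂ) (fun _ : ∀ i, G i => (0 : ℂ))
    simpa using h
  | insert i s hi ih =>
    have h1 := (posSemidef_inner (fun x : ∀ i, G i => (‖A i‖ : ℂ) • x i)).hadamard ih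
    have h2 := (posSemidef_inner_sub (A i) (fun x : ∀ i, G i => x i)).hadamard
      ((posSemidef_prod s).submatrix (fun (x : ∀ i, G i) i => A i (x i)))
    refine (congrArg Matrix.PosSemidef ?_).mpr (h1.add h2)
    ext x y
    simp only [Finset.prod_insert hi, Matrix.of_apply, Matrix.add_apply, Matrix.hadamard_apply,
      Matrix.submatrix_apply, inner_smul_left, inner_smul_right, Complex.conj_ofReal]
    ring

theorem exists_finsupp (t : ⨂[ℂ] i, G i) :
    ∃ c : (∀ i, G i) →₀ ℂ, t = c.sum fun x a => a • PiTensorProduct.tprod ℂ x := by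
  have h : t ∈ Submodule.span ℂ (Set.range (PiTensorProduct.tprod ℂ (s := G))) := by
    rw [PiTensorProduct.span_tprod_eq_top]; trivial
  obtain ⟨c, hc⟩ := Finsupp.mem_span_range_iff_exists_finsupp.mp h
  exact ⟨c, hc.symm⟩

theorem conj_conjInner_sum [Fintype ι] (c : (∀ i, G i) →₀ ℂ) :
    conj (conjInner (c.sum fun x a => a • PiTensorProduct.tprod ℂ x)
      (c.sum fun x a => a • PiTensorProduct.tprod ℂ x)) =
    c.sum fun x a => c.sum fun y b => star a * (∏ i, ⟪x i, y i⟫_ℂ) * b := by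
  simp only [Finsupp.sum, map_sum, map_smul, conjInner_tprod, smul_eq_mul, map_mul,
    innerTprod_tprod, Finset.mul_sum, starRingEnd_apply, star_star]
  exact Finset.sum_congr rfl fun i _ => Finset.sum_congr rfl fun j _ => by ring

end Positivity

section Space

variable {ι : Type*} [Fintype ι] (G : ι → Type*)
  [∀ i, NormedAddCommGroup (G i)] [∀ i, InnerProductSpace ℂ (G i)]

/-- The algebraic tensor product of the family `G`, to be equipped with the inner product
`⟪⊗ x, ⊗ y⟫ = ∏ i, ⟪x i, y i⟫`. -/
def Algebraic : Type _ := ⨂[ℂ] i, G i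

variable {G} in
/-- The elementary tensor `⊗ i, x i`. -/
def elementary (x : ∀ i, G i) : Algebraic G := PiTensorProduct.tprod ℂ x

instance : AddCommGroup (Algebraic G) := inferInstanceAs (AddCommGroup (⨂[ℂ] i, G i))

instance : Module ℂ (Algebraic G) := inferInstanceAs (Module ℂ (⨂[ℂ] i, G i))

instance : PreInnerProductSpace.Core ℂ (Algebraic G) where
  inner s t := conj (conjInner (G := G) t s)
  conj_inner_symm s t := by
    simp only [Complex.conj_conj]
    exact (conjInner_symm (G := G) s t).symm
  re_inner_nonneg t := by
    obtain ⟨c, rfl⟩ := exists_finsupp (G := G) t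
    have h := ((posSemidef_prod (Finset.univ : Finset ι)).2 : ∀ c : (∀ i, G i) →₀ ℂ, _) c
    simp only [Matrix.of_apply] at h
    rw [← conj_conjInner_sum] at h
    exact (Complex.le_def.mp h).1
  add_left s s' t := by
    have h := map_add (conjInner (G := G) t) s s'
    exact (congrArg conj h).trans (map_add _ _ _)
  smul_left s t r := by
    have h := map_smul (conjInner (G := G) t) r s
    exact (congrArg conj h).trans (map_mul _ _ _)

instance : SeminormedAddCommGroup (Algebraic G) :=
  InnerProductSpace.Core.toSeminormedAddCommGroup (𝕜 := ℂ)

instance : InnerProductSpace ℂ (Algebraic G) := InnerProductSpace.ofCore _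

variable {G} in
/-- The algebraic tensor product of linear maps. -/
def algebraicMap (A : ∀ i, G i →L[ℂ] G i) : Algebraic G →ₗ[ℂ] Algebraic G :=
  PiTensorProduct.map fun i => (A i : G i →ₗ[ℂ] G i)

end Space

end HilbertTensor

section TensorOperators

variable {ι : Type*} [Fintype ι]

/-- The Hilbert space tensor product `⨂ i, G i` of a finite family of Hilbert spaces: the
completion of the algebraic tensor product for the inner product
`⟪⊗ x, ⊗ y⟫ = ∏ i, ⟪x i, y i⟫`. -/
abbrev HilbertTensor (G : ι → Type*) [∀ i, NormedAddCommGroup (G i)]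
    [∀ i, InnerProductSpace ℂ (G i)] : Type _ :=
  UniformSpace.Completion (HilbertTensor.Algebraic G)

variable {G : ι → Type*} [∀ i, NormedAddCommGroup (G i)] [∀ i, InnerProductSpace ℂ (G i)]

/-- The product vector `⊗ i, x i`. -/
def productVector (x : ∀ i, G i) : HilbertTensor G :=
  (HilbertTensor.elementary x : UniformSpace.Completion (HilbertTensor.Algebraic G))

theorem inner_productVector (x y : ∀ i, G i) :
    ⟪productVector x, productVector y⟫_ℂ = ∏ i, ⟪x i, y i⟫_ℂ := by
  rw [productVector, productVector, UniformSpace.Completion.inner_coe]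
  change conj (HilbertTensor.conjInner (G := G) (PiTensorProduct.tprod ℂ y)
    (PiTensorProduct.tprod ℂ x)) = _
  simp

theorem HilbertTensor.norm_map_le (A : ∀ i, G i →L[ℂ] G i) (t : HilbertTensor.Algebraic G) :
    ‖HilbertTensor.algebraicMap A t‖ ≤ (∏ i, ‖A i‖) * ‖t‖ := by
  obtain ⟨c, rfl⟩ := HilbertTensor.exists_finsupp (G := G) t
  have hmap : (PiTensorProduct.map (fun i => (A i : G i →ₗ[ℂ] G i))
      (c.sum fun x a => a • PiTensorProduct.tprod ℂ x) : ⨂[ℂ] i, G i) =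
      c.sum fun x a => a • PiTensorProduct.tprod ℂ fun i => A i (x i) := by
    simp [Finsupp.sum, map_sum, PiTensorProduct.map_tprod]
  have h := (HilbertTensor.posSemidef_prod_sub A Finset.univ).2 c
  simp only [Matrix.of_apply] at h
  have hsub : (c.sum fun x a => c.sum fun y b => star a *
      ((∏ i, (‖A i‖ : ℂ) ^ 2) * ∏ i, ⟪x i, y i⟫_ℂ - ∏ i, ⟪A i (x i), A i (y i)⟫_ℂ) * b) =
      (∏ i, (‖A i‖ : ℂ) ^ 2) *
        (c.sum fun x a => c.sum fun y b => star a * (∏ i, ⟪x i, y i⟫_ℂ) * b) -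
      c.sum fun x a => c.sum fun y b => star a * (∏ i, ⟪A i (x i), A i (y i)⟫_ℂ) * b := by
    simp only [Finsupp.sum, Finset.mul_sum, ← Finset.sum_sub_distrib]
    exact Finset.sum_congr rfl fun i _ => Finset.sum_congr rfl fun j _ => by ring
  have hA : conj (HilbertTensor.conjInner (G := G)
      (c.sum fun x a => a • PiTensorProduct.tprod ℂ fun i => A i (x i))
      (c.sum fun x a => a • PiTensorProduct.tprod ℂ fun i => A i (x i))) =
      c.sum fun x a => c.sum fun y b => star a * (∏ i, ⟪A i (x i), A i (y i)⟫_ℂ) * b := by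
    simp only [Finsupp.sum, map_sum, map_smul, HilbertTensor.conjInner_tprod, smul_eq_mul, map_mul,
      HilbertTensor.innerTprod_tprod, Finset.mul_sum, starRingEnd_apply, star_star]
    exact Finset.sum_congr rfl fun i _ => Finset.sum_congr rfl fun j _ => by ring
  rw [hsub, ← HilbertTensor.conj_conjInner_sum, ← hA] at h
  set s : HilbertTensor.Algebraic G := c.sum fun x a => a • PiTensorProduct.tprod ℂ x with hs
  set s' : HilbertTensor.Algebraic G :=
    c.sum fun x a => a • PiTensorProduct.tprod ℂ fun i => A i (x i) with hs'
  have hs2 : HilbertTensor.algebraicMap A s = s' := hmap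
  change ‖HilbertTensor.algebraicMap A s‖ ≤ (∏ i, ‖A i‖) * ‖s‖
  rw [hs2]
  have e1 : conj (HilbertTensor.conjInner (G := G) s s) = ((‖s‖ : ℂ)) ^ 2 :=
    inner_self_eq_norm_sq_to_K (𝕜 := ℂ) s
  have e2 : conj (HilbertTensor.conjInner (G := G) s' s') = ((‖s'‖ : ℂ)) ^ 2 :=
    inner_self_eq_norm_sq_to_K (𝕜 := ℂ) s'
  change 0 ≤ (∏ i, (‖A i‖ : ℂ) ^ 2) * conj (HilbertTensor.conjInner (G := G) s s) -
    conj (HilbertTensor.conjInner (G := G) s' s') at h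
  rw [e1, e2, sub_nonneg, Finset.prod_pow, ← mul_pow] at h
  have h' : ‖s'‖ ^ 2 ≤ ((∏ i, ‖A i‖) * ‖s‖) ^ 2 := by exact_mod_cast h
  exact le_of_sq_le_sq h' (mul_nonneg (Finset.prod_nonneg fun i _ => norm_nonneg _) (norm_nonneg _))

/-- The tensor product `⊗ i, A i` of bounded operators, a bounded operator on `⨂ i, G i`. -/
def tensorOperator (A : ∀ i, G i →L[ℂ] G i) : HilbertTensor G →L[ℂ] HilbertTensor G :=
  ContinuousLinearMap.completion
    (LinearMap.mkContinuous (HilbertTensor.algebraicMap A)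
      (∏ i, ‖A i‖) (HilbertTensor.norm_map_le A))

theorem tensorOperator_productVector (A : ∀ i, G i →L[ℂ] G i) (x : ∀ i, G i) :
    tensorOperator A (productVector x) = productVector fun i => A i (x i) := by
  rw [tensorOperator, productVector, ContinuousLinearMap.completion_apply_coe, productVector]
  congr 1
  exact PiTensorProduct.map_tprod _ _

end TensorOperators

section TraceClass

variable {E : Type*} [NormedAddCommGroup E] [InnerProductSpace ℂ E] [CompleteSpace E]

/-- A bounded operator `T` is trace class if `tr |T| < ∞`, where `|T| = √(T† T)` and the trace of
the positive operator `|T|` is computed in a complete orthonormal system. -/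
def IsTraceClass (T : E →L[ℂ] E) : Prop :=
  ∃ (w : Set E) (b : HilbertBasis w ℂ E), Summable fun i => (⟪b i, CFC.abs T (b i)⟫_ℂ).re

/-- The trace `tr T = ∑ i, ⟪b i, T (b i)⟫` in a complete orthonormal system `b` (for trace class
operators the value does not depend on the choice of `b`). -/
def opTrace (T : E →L[ℂ] E) : ℂ :=
  ∑' i, ⟪(exists_hilbertBasis ℂ E).choose_spec.choose i,
    T ((exists_hilbertBasis ℂ E).choose_spec.choose i)⟫_ℂ

/-- Quantum states (density operators): positive trace class operators of unit trace. -/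
structure IsState (ρ : E →L[ℂ] E) : Prop where
  isPositive : ρ.IsPositive
  isTraceClass : IsTraceClass ρ
  opTrace_eq_one : opTrace ρ = 1

end TraceClass

/-- Tensor positivity of a bounded operator `Z` on `⨂ i, G i`: the scalar product
`⟪⊗ ψ, Z (⊗ ψ)⟫` is (real and) nonnegative for all product vectors. -/
def TensorPositive {ι : Type*} [Fintype ι] {G : ι → Type*} [∀ i, NormedAddCommGroup (G i)]
    [∀ i, InnerProductSpace ℂ (G i)] (Z : HilbertTensor G →L[ℂ] HilbertTensor G) : Prop :=
  ∀ ψ : ∀ i, G i, 0 ≤ ⟪productVector ψ, Z (productVector ψ)⟫_ℂ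

section Source

variable {N : ℕ} (H : Fin N → Type u) [∀ n, NormedAddCommGroup (H n)]
  [∀ n, InnerProductSpace ℂ (H n)]

/-- The space `(H 1)^{⊗ S 1} ⊗ ⋯ ⊗ (H N)^{⊗ S N}`: the factors are indexed by the pairs `(n, k)`
with `k < S n`, and the factor with index `(n, k)` is `H n`. -/
abbrev SourceSpace (S : Fin N → ℕ) : Type u :=
  HilbertTensor fun p : (n : Fin N) × Fin (S n) => H p.1

variable {H} [∀ n, CompleteSpace (H n)]

/-- `T` is an `S 1 × ⋯ × S N`-setting source operator for `ρ`: a self-adjoint trace class operator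
such that, for every choice of one copy `k n` of `H n` at each site `n` and all bounded `X n` on
`H n`, the trace of `T` times the operator acting as `X n` on the `k n`-th copy of `H n`, and as the
identity on all other copies, is `tr [ρ (X 1 ⊗ ⋯ ⊗ X N)]`. -/
structure IsSourceOperator (ρ : HilbertTensor H →L[ℂ] HilbertTensor H) (S : Fin N → ℕ)
    (T : SourceSpace H S →L[ℂ] SourceSpace H S) : Prop where
  isSelfAdjoint : IsSelfAdjoint T
  isTraceClass : IsTraceClass T
  opTrace_eq : ∀ (k : ∀ n, Fin (S n)) (X : ∀ n, H n →L[ℂ] H n),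
    opTrace (T ∘L tensorOperator fun p : (n : Fin N) × Fin (S n) =>
      if p.2 = k p.1 then X p.1 else ContinuousLinearMap.id ℂ (H p.1)) =
    opTrace (ρ ∘L tensorOperator X)

end Source

/-- A normalized positive operator-valued (POV) measure on `Λ` with values in the bounded operators
on `E`; countable additivity is in the weak sense (the values on nonmeasurable sets are
irrelevant). -/
structure POVM (Λ : Type*) [MeasurableSpace Λ] (E : Type*) [NormedAddCommGroup E]
    [InnerProductSpace ℂ E] where
  effect : Set Λ → (E →L[ℂ] E)
  isPositive : ∀ F, MeasurableSet F → (effect F).IsPositive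
  effect_univ : effect Set.univ = ContinuousLinearMap.id ℂ E
  hasSum_iUnion : ∀ F : ℕ → Set Λ, (∀ i, MeasurableSet (F i)) →
    Pairwise (Function.onFun Disjoint F) → ∀ ψ : E,
    HasSum (fun i => ⟪ψ, effect (F i) ψ⟫_ℂ) ⟪ψ, effect (⋃ i, F i) ψ⟫_ℂ

section LHV

variable {N : ℕ} {Λ : Fin N → Type v} [∀ n, MeasurableSpace (Λ n)] {S : Fin N → ℕ}

/-- A correlation scenario with `S n` settings and outcomes in `Λ n` at site `n`, whose joint
measurement `s` gives the event `F 1 × ⋯ × F N` the probability `P s F`, admits a local hidden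
variable (LHV) model: there are a probability space `(Ω, ν)` and conditional probability measures
`κ n s ω` on `Λ n`, measurable in `ω`, for each setting `s` at site `n`, with
`P s F = ∫ ∏ n, κ n (s n) ω (F n) ν(dω)`. -/
def AdmitsLHVModel (P : (∀ n, Fin (S n)) → (∀ n, Set (Λ n)) → ℂ) : Prop :=
  ∃ (Ω : Type v) (_ : MeasurableSpace Ω) (ν : Measure Ω) (κ : ∀ n, Fin (S n) → Kernel Ω (Λ n)),
    IsProbabilityMeasure ν ∧ (∀ n s, IsMarkovKernel (κ n s)) ∧
    ∀ (s : ∀ n, Fin (S n)) (F : ∀ n, Set (Λ n)), (∀ n, MeasurableSet (F n)) →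
      P s F = ((∫ ω, ∏ n, (κ n (s n) ω).real (F n) ∂ν : ℝ) : ℂ)

variable {H : Fin N → Type u} [∀ n, NormedAddCommGroup (H n)]
  [∀ n, InnerProductSpace ℂ (H n)]

/-- The joint probabilities `tr [ρ (M 1 (s 1) (F 1) ⊗ ⋯ ⊗ M N (s N) (F N))]` of the quantum
correlation scenario on `ρ` with the POV measures `M n s`. -/
def quantumProbability (ρ : HilbertTensor H →L[ℂ] HilbertTensor H)
    (M : ∀ n, Fin (S n) → POVM (Λ n) (H n)) (s : ∀ n, Fin (S n)) (F : ∀ n, Set (Λ n)) : ℂ :=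
  opTrace (ρ ∘L tensorOperator fun n => (M n (s n)).effect (F n))

end LHV

/-- `ρ` admits the `S 1 × ⋯ × S N`-setting LHV description: every quantum correlation scenario on
`ρ` with `S n` POV measures at each site `n` admits an LHV model, for all standard measurable
outcome spaces. -/
def AdmitsLHVDescription {N : ℕ} {H : Fin N → Type u} [∀ n, NormedAddCommGroup (H n)]
    [∀ n, InnerProductSpace ℂ (H n)] (ρ : HilbertTensor H →L[ℂ] HilbertTensor H)
    (S : Fin N → ℕ) : Prop :=
  ∀ (Λ : Fin N → Type v) [∀ n, MeasurableSpace (Λ n)] [∀ n, StandardBorelSpace (Λ n)]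
    (M : ∀ n, Fin (S n) → POVM (Λ n) (H n)), AdmitsLHVModel (quantumProbability ρ M)

end

/-! ### Finitely additive families of measures and kernels -/

section Bimeasure

open Set Filter
open scoped Topology ENNReal

/-! Let `T` be a tensor positive source operator and single out one copy of the factor at site `n`.
Every copy `(m, j)` with `m ≠ n` carries the `j`-th observable of site `m`, the singled-out copy
carries the observable of a setting `t` at site `n`, and the remaining copies of that factor carry
an arbitrary fixed observable. All these observables act on different tensor factors, so the traces
of `T` against products of their effects define a function of measurable rectangles. It is
nonnegative by tensor positivity, additive in each side, and normalized.

For standard Borel outcomes this function extends to a probability measure on the product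
(`IsMultimeasure.exists_measure`). Replacing `t` by another setting does not affect the marginal on
the other copies, because full effects are identities. This common marginal is the hidden variable
distribution: each site `m ≠ n` reads its outcome off the coordinate of the measured copy, and site
`n` answers setting `t` with the conditional distribution of the singled-out outcome
(`IsMultimeasure.exists_kernels`, `admitsLHVModel_of_multimeasures`). Any number of settings at site
`n` is therefore allowed. A state is itself tensor positive, so with one copy per site it plays the
role of `T`.

There are two analytic inputs. Nonnegativity of traces (`TensorPositive.opTrace_comp_nonneg`)
follows by moving square roots of the effects onto a product basis. The extension to measures goes
by induction on the number of factors, one disintegration per factor (`IsBimeasure.exists_kernel`);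
it needs countable additivity of the one-dimensional marginals only. -/

theorem isRatStieltjesPoint_of_bounds {X : Type*} {f : X → ℚ → ℝ} {x : X} (hmono : Monotone (f x))
    (h0 : ∀ q, 0 ≤ f x q) (h1 : ∀ q, f x q ≤ 1)
    (hbot : ∀ ε > 0, ∃ q, f x q < ε) (htop : ∀ ε > 0, ∃ q, 1 - ε < f x q)
    (hright : ∀ q, ∀ ε > 0, ∃ r > q, f x r < f x q + ε) : IsRatStieltjesPoint f x where
  mono := hmono
  tendsto_atTop_one := tendsto_order.mpr
    ⟨fun a ha => by
      obtain ⟨q, hq⟩ := htop (1 - a) (by linarith)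
      filter_upwards [eventually_ge_atTop q] with r hr
      linarith [hmono hr],
    fun a ha => Eventually.of_forall fun q => (h1 q).trans_lt ha⟩
  tendsto_atBot_zero := tendsto_order.mpr
    ⟨fun a ha => Eventually.of_forall fun q => ha.trans_le (h0 q),
    fun a ha => by
      obtain ⟨q, hq⟩ := hbot a ha
      filter_upwards [eventually_le_atBot q] with r hr
      linarith [hmono hr]⟩
  iInf_rat_gt_eq q := by
    have hbdd : BddBelow (range fun r : Ioi q => f x r) :=
      ⟨0, by rintro _ ⟨r, rfl⟩; exact h0 r⟩
    refine le_antisymm (le_of_forall_pos_le_add fun ε hε => ?_) ?_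
    · obtain ⟨r, hr, hlt⟩ := hright q ε hε
      exact (ciInf_le hbdd ⟨r, hr⟩).trans hlt.le
    · have : Nonempty (Ioi q) := ⟨⟨q + 1, by simp⟩⟩
      exact le_ciInf fun r => hmono r.2.le

/-- A family of measures on `X`, indexed by the subsets of `Y`, which is additive on disjoint
measurable sets and whose total mass is continuous from above at `∅`. -/
structure IsBimeasure {X Y : Type*} [MeasurableSpace X] [MeasurableSpace Y]
    (β : Set Y → Measure X) : Prop where
  finite : IsFiniteMeasure (β univ)
  add : ∀ A B, MeasurableSet A → MeasurableSet B → Disjoint A B → β (A ∪ B) = β A + β B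
  tendsto : ∀ D : ℕ → Set Y, (∀ k, MeasurableSet (D k)) → Antitone D → ⋂ k, D k = ∅ →
    Tendsto (fun k => β (D k) univ) atTop (𝓝 0)

namespace IsBimeasure

variable {X Y : Type*} [MeasurableSpace X] [MeasurableSpace Y] {β : Set Y → Measure X}

theorem mono (h : IsBimeasure β) {A B : Set Y} (hA : MeasurableSet A) (hB : MeasurableSet B)
    (hAB : A ⊆ B) : β A ≤ β B := by
  have e := h.add A (B \ A) hA (hB.diff hA) disjoint_sdiff_right
  rw [union_sdiff_cancel hAB] at e
  rw [e]
  exact Measure.le_add_right le_rfl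

theorem isFiniteMeasure (h : IsBimeasure β) {A : Set Y} (hA : MeasurableSet A) :
    IsFiniteMeasure (β A) := by
  have := h.finite
  exact isFiniteMeasure_of_le _ (h.mono hA MeasurableSet.univ (subset_univ A))

theorem absolutelyContinuous (h : IsBimeasure β) {A : Set Y} (hA : MeasurableSet A) :
    β A ≪ β univ :=
  (h.mono hA MeasurableSet.univ (subset_univ A)).absolutelyContinuous

theorem setLIntegral_rnDeriv (h : IsBimeasure β) {A : Set Y} (hA : MeasurableSet A) (s : Set X) :
    ∫⁻ x in s, (β A).rnDeriv (β univ) x ∂(β univ) = β A s := by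
  have := h.finite
  have := h.isFiniteMeasure hA
  exact Measure.setLIntegral_rnDeriv (h.absolutelyContinuous hA) s

theorem rnDeriv_mono (h : IsBimeasure β) {A B : Set Y} (hA : MeasurableSet A)
    (hB : MeasurableSet B) (hAB : A ⊆ B) :
    (β A).rnDeriv (β univ) ≤ᵐ[β univ] (β B).rnDeriv (β univ) := by
  have := h.finite
  refine ae_le_of_forall_setLIntegral_le_of_sigmaFinite (Measure.measurable_rnDeriv _ _) ?_
  intro s _ _
  rw [h.setLIntegral_rnDeriv hA, h.setLIntegral_rnDeriv hB]
  exact h.mono hA hB hAB s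

theorem rnDeriv_add (h : IsBimeasure β) {A B : Set Y} (hA : MeasurableSet A)
    (hB : MeasurableSet B) (hAB : Disjoint A B) :
    (β (A ∪ B)).rnDeriv (β univ) =ᵐ[β univ]
      (β A).rnDeriv (β univ) + (β B).rnDeriv (β univ) := by
  have := h.finite
  have := h.isFiniteMeasure hA
  have := h.isFiniteMeasure hB
  rw [h.add A B hA hB hAB]
  exact Measure.rnDeriv_add _ _ _

/-- The infimum of the densities has integral at most `β (D k) univ` for every `k`, hence zero. This
turns continuity at `∅` into pointwise almost everywhere limits. -/
theorem ae_exists_rnDeriv_lt (h : IsBimeasure β) {D : ℕ → Set Y} (hD : ∀ k, MeasurableSet (D k))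
    (hmono : Antitone D) (hempty : ⋂ k, D k = ∅) :
    ∀ᵐ x ∂(β univ), ∀ ε : ℝ≥0∞, 0 < ε → ∃ k, (β (D k)).rnDeriv (β univ) x < ε := by
  have h0 : ∫⁻ x, ⨅ k, (β (D k)).rnDeriv (β univ) x ∂(β univ) = 0 := by
    refine le_antisymm ?_ bot_le
    refine ge_of_tendsto' (h.tendsto D hD hmono hempty) fun k => ?_
    rw [← h.setLIntegral_rnDeriv (hD k) univ, Measure.restrict_univ]
    exact lintegral_mono fun x => iInf_le _ k
  rw [lintegral_eq_zero_iff (Measurable.iInf fun k => Measure.measurable_rnDeriv _ _)] at h0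
  filter_upwards [h0] with x hx ε hε
  exact iInf_lt_iff.mp (hx.trans_lt hε)

/-- The conditional distribution function of a bimeasure on `X × ℝ`. -/
noncomputable def ratCDF (β : Set ℝ → Measure X) (x : X) (q : ℚ) : ℝ :=
  ((β (Iic (q : ℝ))).rnDeriv (β univ) x).toReal

theorem measurable_ratCDF (β : Set ℝ → Measure X) : Measurable (ratCDF β) :=
  measurable_pi_iff.mpr fun _ => (Measure.measurable_rnDeriv _ _).ennreal_toReal

/-- Each property of a distribution function on `ℚ` amounts to countably many almost everywhere
statements about densities. The two limits and right continuity come from sets decreasing to `∅`: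
`Iic (-k)`, `Ioi k` and `Ioc q (q + 1 / (k + 1))`. -/
theorem ae_isRatStieltjesPoint {β : Set ℝ → Measure X} (h : IsBimeasure β) :
    ∀ᵐ x ∂(β univ), IsRatStieltjesPoint (ratCDF β) x := by
  have := h.finite
  have hone : ∀ᵐ x ∂(β univ), (β univ).rnDeriv (β univ) x = 1 := Measure.rnDeriv_self _
  have hle : ∀ᵐ x ∂(β univ), ∀ q : ℚ,
      (β (Iic (q : ℝ))).rnDeriv (β univ) x ≤ (β univ).rnDeriv (β univ) x :=
    ae_all_iff.mpr fun q => h.rnDeriv_mono measurableSet_Iic .univ (subset_univ _)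
  have hmono : ∀ᵐ x ∂(β univ), ∀ q r : ℚ, q ≤ r →
      (β (Iic (q : ℝ))).rnDeriv (β univ) x ≤ (β (Iic (r : ℝ))).rnDeriv (β univ) x := by
    refine ae_all_iff.mpr fun q => ae_all_iff.mpr fun r => ?_
    by_cases hqr : q ≤ r
    · filter_upwards [h.rnDeriv_mono (measurableSet_Iic (a := (q : ℝ)))
        (measurableSet_Iic (a := (r : ℝ))) (Iic_subset_Iic.mpr (by exact_mod_cast hqr))] with x hx _
      exact hx
    · exact Eventually.of_forall fun x hx => absurd hx hqr
  have hbot := h.ae_exists_rnDeriv_lt (D := fun k : ℕ => Iic (((-k : ℤ) : ℚ) : ℝ))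
    (fun k => measurableSet_Iic)
    (fun k l hkl => Iic_subset_Iic.mpr (by push_cast; simpa using hkl))
    (by
      refine eq_empty_iff_forall_notMem.mpr fun y hy => ?_
      obtain ⟨k, hk⟩ := exists_nat_gt (-y)
      have := mem_iInter.mp hy k
      simp at this
      linarith)
  have htop := h.ae_exists_rnDeriv_lt (D := fun k : ℕ => Ioi (((k : ℕ) : ℚ) : ℝ))
    (fun k => measurableSet_Ioi)
    (fun k l hkl => Ioi_subset_Ioi (by push_cast; simpa using hkl))
    (by
      refine eq_empty_iff_forall_notMem.mpr fun y hy => ?_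
      obtain ⟨k, hk⟩ := exists_nat_gt y
      have := mem_iInter.mp hy k
      simp at this
      linarith)
  have htop' : ∀ᵐ x ∂(β univ), ∀ k : ℕ, (β univ).rnDeriv (β univ) x =
      (β (Iic (((k : ℕ) : ℚ) : ℝ))).rnDeriv (β univ) x +
        (β (Ioi (((k : ℕ) : ℚ) : ℝ))).rnDeriv (β univ) x := by
    refine ae_all_iff.mpr fun k => ?_
    have e := h.rnDeriv_add (measurableSet_Iic (a := (((k : ℕ) : ℚ) : ℝ)))
      (measurableSet_Ioi (a := (((k : ℕ) : ℚ) : ℝ))) (Iic_disjoint_Ioi le_rfl)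
    rw [Iic_union_Ioi] at e
    exact e
  have hright : ∀ᵐ x ∂(β univ), ∀ q : ℚ, ∀ ε : ℝ≥0∞, 0 < ε → ∃ k : ℕ,
      (β (Ioc (q : ℝ) ((q + 1 / (k + 1) : ℚ) : ℝ))).rnDeriv (β univ) x < ε := by
    refine ae_all_iff.mpr fun q => ?_
    refine h.ae_exists_rnDeriv_lt (fun k => measurableSet_Ioc) (fun k l hkl => ?_) ?_
    · refine Ioc_subset_Ioc_right ?_
      push_cast
      have : (k : ℝ) ≤ l := by exact_mod_cast hkl
      gcongr
    · refine eq_empty_iff_forall_notMem.mpr fun y hy => ?_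
      have hy0 := (mem_iInter.mp hy 0).1
      obtain ⟨k, hk⟩ := exists_nat_one_div_lt (sub_pos.mpr hy0)
      have := (mem_iInter.mp hy k).2
      push_cast at this
      linarith
  have hright' : ∀ᵐ x ∂(β univ), ∀ q : ℚ, ∀ k : ℕ,
      (β (Iic ((q + 1 / (k + 1) : ℚ) : ℝ))).rnDeriv (β univ) x =
      (β (Iic (q : ℝ))).rnDeriv (β univ) x +
        (β (Ioc (q : ℝ) ((q + 1 / (k + 1) : ℚ) : ℝ))).rnDeriv (β univ) x := by
    refine ae_all_iff.mpr fun q => ae_all_iff.mpr fun k => ?_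
    have e := h.rnDeriv_add (measurableSet_Iic (a := (q : ℝ)))
      (measurableSet_Ioc (a := (q : ℝ)) (b := ((q + 1 / (k + 1) : ℚ) : ℝ)))
      ((Iic_disjoint_Ioi le_rfl).mono_right Ioc_subset_Ioi_self)
    rw [Iic_union_Ioc_eq_Iic] at e
    · exact e
    · have : (0 : ℚ) ≤ 1 / (k + 1) := by positivity
      exact_mod_cast le_add_of_nonneg_right this
  filter_upwards [hone, hle, hmono, hbot, htop, htop', hright, hright'] with
    x hone hle hmono hbot htop htop' hright hright'
  rw [hone] at hle htop'
  have hfin : ∀ q : ℚ, (β (Iic (q : ℝ))).rnDeriv (β univ) x ≠ ∞ :=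
    fun q => ne_top_of_le_ne_top ENNReal.one_ne_top (hle q)
  refine isRatStieltjesPoint_of_bounds ?_ (fun q => ENNReal.toReal_nonneg) ?_ ?_ ?_ ?_
  · exact fun q r hqr => ENNReal.toReal_mono (hfin r) (hmono q r hqr)
  · exact fun q => ENNReal.toReal_le_of_le_ofReal zero_le_one (by simpa using hle q)
  · intro ε hε
    obtain ⟨k, hk⟩ := hbot (ENNReal.ofReal ε) (by simpa using hε)
    exact ⟨_, (ENNReal.lt_ofReal_iff_toReal_lt (hfin _)).mp hk⟩
  · intro ε hε
    obtain ⟨k, hk⟩ := htop (ENNReal.ofReal ε) (by simpa using hε)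
    have hk' := (ENNReal.lt_ofReal_iff_toReal_lt hk.ne_top).mp hk
    have e := congrArg ENNReal.toReal (htop' k)
    rw [ENNReal.toReal_add (hfin _) hk.ne_top, ENNReal.toReal_one] at e
    refine ⟨k, ?_⟩
    rw [ratCDF]
    linarith
  · intro q ε hε
    obtain ⟨k, hk⟩ := hright q (ENNReal.ofReal ε) (by simpa using hε)
    have hk' := (ENNReal.lt_ofReal_iff_toReal_lt hk.ne_top).mp hk
    have e := congrArg ENNReal.toReal (hright' q k)
    rw [ENNReal.toReal_add (hfin _) hk.ne_top] at e
    refine ⟨q + 1 / (k + 1), ?_, ?_⟩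
    · have : (0 : ℚ) < 1 / (k + 1) := by positivity
      exact lt_add_of_pos_right q this
    · rw [ratCDF, ratCDF, e]
      linarith

theorem empty (h : IsBimeasure β) : β ∅ = 0 := by
  have := h.isFiniteMeasure (A := ∅) .empty
  have e := h.add ∅ ∅ .empty .empty (disjoint_empty _)
  rw [union_empty] at e
  ext s _
  have e' : β ∅ s + 0 = β ∅ s + β ∅ s := by
    rw [add_zero, ← Measure.add_apply, ← e]
  exact ((ENNReal.add_right_inj (measure_ne_top _ _)).mp e').symm

/-- The tails `R n` decrease to `∅`, and the mass they give to any `s` is bounded by their total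
mass, which tends to zero. -/
theorem iUnion_apply (h : IsBimeasure β) {D : ℕ → Set Y} (hD : ∀ k, MeasurableSet (D k))
    (hdisj : Pairwise (Function.onFun Disjoint D)) (s : Set X) :
    β (⋃ k, D k) s = ∑' k, β (D k) s := by
  have hfin : ∀ n : ℕ, β (⋃ k ∈ Finset.range n, D k) = ∑ k ∈ Finset.range n, β (D k) := by
    intro n
    induction n with
    | zero => simpa using h.empty
    | succ n ih =>
      rw [Finset.sum_range_succ, Finset.range_add_one, Finset.set_biUnion_insert, union_comm,
        h.add _ _ (Finset.measurableSet_biUnion _ fun k _ => hD k) (hD n) ?_, ih]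
      simp only [disjoint_iUnion_left]
      intro k hk
      exact hdisj (Finset.mem_range.mp hk).ne
  set R : ℕ → Set Y := fun n => (⋃ k, D k) \ ⋃ k ∈ Finset.range n, D k with hR
  have hU : MeasurableSet (⋃ k, D k) := .iUnion hD
  have hV : ∀ n, MeasurableSet (⋃ k ∈ Finset.range n, D k) :=
    fun n => Finset.measurableSet_biUnion _ fun k _ => hD k
  have hlim : Tendsto (fun n => β (R n) s) atTop (𝓝 0) := by
    refine tendsto_of_tendsto_of_tendsto_of_le_of_le tendsto_const_nhds
      (h.tendsto R (fun n => hU.diff (hV n)) ?_ ?_) (fun n => zero_le)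
      (fun n => measure_mono (subset_univ s))
    · intro m n hmn
      exact sdiff_subset_sdiff_right (biUnion_subset_biUnion_left (by simpa using hmn))
    · refine eq_empty_iff_forall_notMem.mpr fun y hy => ?_
      obtain ⟨k, hk⟩ := mem_iUnion.mp (mem_iInter.mp hy 0).1
      refine (mem_iInter.mp hy (k + 1)).2 (mem_biUnion (x := k) (by simp) hk)
  have hsum : ∀ n, β (⋃ k, D k) s = ∑ k ∈ Finset.range n, β (D k) s + β (R n) s := by
    intro n
    have e := h.add _ _ (hV n) (hU.diff (hV n)) disjoint_sdiff_right
    rw [union_sdiff_cancel (iUnion₂_subset fun k _ => subset_iUnion D k), hfin] at e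
    rw [e]
    simp [hR]
  have h1 := (ENNReal.tendsto_nat_tsum fun k => β (D k) s).add hlim
  rw [add_zero] at h1
  exact tendsto_nhds_unique (tendsto_const_nhds.congr hsum) h1

/-- The kernel is the Stieltjes measure of the conditional distribution function. On rational
half-lines the identity is the Radon–Nikodym theorem; a π-λ argument carries it to all Borel sets.
-/
theorem exists_kernel_real {β : Set ℝ → Measure X} (h : IsBimeasure β) :
    ∃ κ : Kernel X ℝ, IsMarkovKernel κ ∧ ∀ B, MeasurableSet B → ∀ A, MeasurableSet A →
      ∫⁻ x in A, κ x B ∂(β univ) = β B A := by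
  have := h.finite
  have hf := measurable_ratCDF β
  let κ : Kernel X ℝ := ⟨fun x => (stieltjesOfMeasurableRat (ratCDF β) hf x).measure,
    measurable_measure_stieltjesOfMeasurableRat hf⟩
  have hκ : IsMarkovKernel κ := ⟨fun x => ⟨measure_stieltjesOfMeasurableRat_univ hf x⟩⟩
  refine ⟨κ, hκ, fun B hB A hA => ?_⟩
  induction B, hB using MeasurableSpace.induction_on_inter Real.borel_eq_generateFrom_Iic_rat
    Real.isPiSystem_Iic_rat with
  | empty => simp [h.empty]
  | basic t ht =>
    obtain ⟨q, rfl⟩ : ∃ q : ℚ, Iic (q : ℝ) = t := by simpa [eq_comm] using ht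
    rw [← h.setLIntegral_rnDeriv measurableSet_Iic A]
    refine setLIntegral_congr_fun_ae hA ?_
    have hle := h.rnDeriv_mono (measurableSet_Iic (a := (q : ℝ))) .univ (subset_univ _)
    filter_upwards [h.ae_isRatStieltjesPoint, hle, Measure.rnDeriv_self (β univ)] with
      x hx hx1 hx2 _
    change (stieltjesOfMeasurableRat (ratCDF β) hf x).measure (Iic (q : ℝ)) = _
    rw [measure_stieltjesOfMeasurableRat_Iic, stieltjesOfMeasurableRat_eq,
      toRatCDF_of_isRatStieltjesPoint hx, ratCDF, ENNReal.ofReal_toReal]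
    exact ne_top_of_le_ne_top (by simp [hx2]) hx1
  | compl t ht ih =>
    have e := h.add t tᶜ ht ht.compl disjoint_compl_right
    rw [union_compl_self] at e
    have e' := congrArg (fun m => m A) e
    simp only [Measure.add_apply] at e'
    have hfin := h.isFiniteMeasure ht
    rw [show ∫⁻ x in A, κ x tᶜ ∂(β univ) = ∫⁻ x in A, 1 - κ x t ∂(β univ) from
      lintegral_congr fun x => prob_compl_eq_one_sub ht,
      lintegral_sub (Kernel.measurable_coe κ ht) ?_ (ae_of_all _ fun x => prob_le_one), ih,
      lintegral_one, Measure.restrict_apply_univ, e', ENNReal.add_sub_cancel_left]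
    · exact measure_ne_top _ _
    · rw [ih]
      exact measure_ne_top _ _
  | iUnion D hdisj hD ih =>
    rw [h.iUnion_apply hD hdisj, ← tsum_congr ih, ← lintegral_tsum
      fun k => (Kernel.measurable_coe κ (hD k)).aemeasurable]
    exact lintegral_congr fun x => measure_iUnion hdisj hD

/-- A bimeasure with one standard Borel factor is given by a Markov kernel. -/
theorem exists_kernel [StandardBorelSpace Y] [Nonempty Y] (h : IsBimeasure β) :
    ∃ κ : Kernel X Y, IsMarkovKernel κ ∧ ∀ B, MeasurableSet B → ∀ A, MeasurableSet A →
      ∫⁻ x in A, κ x B ∂(β univ) = β B A := by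
  have := h.finite
  have he := measurableEmbedding_embeddingReal Y
  have h' : IsBimeasure fun B : Set ℝ => β (embeddingReal Y ⁻¹' B) :=
    { finite := h.finite
      add := fun A B hA hB hAB =>
        h.add _ _ (he.measurable hA) (he.measurable hB) (hAB.preimage _)
      tendsto := fun D hD hmono hempty =>
        h.tendsto _ (fun k => he.measurable (hD k)) (fun k l hkl => preimage_mono (hmono hkl))
          (by rw [← preimage_iInter, hempty, preimage_empty]) }
  obtain ⟨η, hη, hη'⟩ := h'.exists_kernel_real
  refine ⟨Kernel.borelMarkovFromReal Y η, inferInstance, fun B hB A hA => ?_⟩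
  have hB' := he.measurableSet_image.mpr hB
  have e := hη' _ hB' A hA
  simp only [preimage_image_eq _ he.injective, preimage_univ] at e
  rw [← e]
  -- The complement of the range has empty preimage, so almost every `η x` lives on the range and
  -- pulling back to `Y` loses no mass.
  have hr : ∀ᵐ x ∂(β univ), η x (range (embeddingReal Y))ᶜ = 0 := by
    have e := hη' _ he.measurableSet_range.compl univ .univ
    rw [preimage_compl, preimage_range, compl_univ, h.empty, Measure.restrict_univ, preimage_univ,
      Measure.coe_zero, Pi.zero_apply, lintegral_eq_zero_iff (Kernel.measurable_coe η he.measurableSet_range.compl)] at e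
    exact e
  refine setLIntegral_congr_fun_ae hA ?_
  filter_upwards [hr] with x hx _
  rw [Kernel.borelMarkovFromReal_apply, if_pos hx, he.comap_apply]

end IsBimeasure

end Bimeasure
/-! ### Finitely additive functions of measurable rectangles -/

section Multimeasure

open Set Filter
open scoped Topology ENNReal

theorem measure_pi_ext {ι : Type*} [Finite ι] {Λ : ι → Type*} [∀ i, MeasurableSpace (Λ i)]
    {m m' : Measure (∀ i, Λ i)} [IsFiniteMeasure m]
    (h : ∀ F : ∀ i, Set (Λ i), (∀ i, MeasurableSet (F i)) → m (univ.pi F) = m' (univ.pi F)) :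
    m = m' := by
  refine MeasureTheory.ext_of_generate_finite _ generateFrom_pi.symm isPiSystem_pi ?_ ?_
  · rintro _ ⟨F, hF, rfl⟩
    exact h F fun i => hF i (mem_univ i)
  · simpa using h (fun _ => univ) fun _ => .univ

/-- A function of measurable rectangles that is additive in each side and whose one-dimensional
marginals are continuous from above at `∅`. -/
structure IsMultimeasure {ι : Type*} [DecidableEq ι] {Λ : ι → Type*} [∀ i, MeasurableSpace (Λ i)]
    (μ : (∀ i, Set (Λ i)) → ℝ≥0∞) : Prop where
  ne_top : μ (fun _ => univ) ≠ ∞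
  add : ∀ F : ∀ i, Set (Λ i), (∀ i, MeasurableSet (F i)) → ∀ i A B, MeasurableSet A →
    MeasurableSet B → Disjoint A B → μ (Function.update F i (A ∪ B)) =
      μ (Function.update F i A) + μ (Function.update F i B)
  tendsto : ∀ i (D : ℕ → Set (Λ i)), (∀ k, MeasurableSet (D k)) → Antitone D → ⋂ k, D k = ∅ →
    Tendsto (fun k => μ (Function.update (fun _ => univ) i (D k))) atTop (𝓝 0)

theorem measurableSet_update {ι : Type*} [DecidableEq ι] {Λ : ι → Type*}
    [∀ i, MeasurableSpace (Λ i)] {F : ∀ i, Set (Λ i)} (hF : ∀ i, MeasurableSet (F i)) {i : ι}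
    {A : Set (Λ i)} (hA : MeasurableSet A) (j : ι) : MeasurableSet (Function.update F i A j) := by
  rcases eq_or_ne j i with rfl | hj
  · simpa using hA
  · simpa [hj] using hF j

namespace IsMultimeasure

section Basic

variable {ι : Type*} [DecidableEq ι] {Λ : ι → Type*} [∀ i, MeasurableSpace (Λ i)]
  {μ : (∀ i, Set (Λ i)) → ℝ≥0∞}

theorem update_mono (h : IsMultimeasure μ) {F : ∀ i, Set (Λ i)} (hF : ∀ i, MeasurableSet (F i))
    {i : ι} {A : Set (Λ i)} (hA : MeasurableSet A) (hFA : F i ⊆ A) :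
    μ F ≤ μ (Function.update F i A) := by
  have e := h.add F hF i (F i) (A \ F i) (hF i) (hA.diff (hF i)) disjoint_sdiff_right
  rw [union_sdiff_cancel hFA, Function.update_eq_self] at e
  rw [e]
  exact le_self_add

/-- The sides are enlarged one at a time, over a growing finite set of indices. -/
theorem mono [Fintype ι] (h : IsMultimeasure μ) {F G : ∀ i, Set (Λ i)}
    (hF : ∀ i, MeasurableSet (F i)) (hG : ∀ i, MeasurableSet (G i)) (hFG : ∀ i, F i ⊆ G i) :
    μ F ≤ μ G := by
  have key : ∀ s : Finset ι, μ F ≤ μ (s.piecewise G F) := by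
    intro s
    induction s using Finset.induction_on with
    | empty => simp
    | insert i s hi ih =>
      rw [Finset.piecewise_insert]
      refine ih.trans (h.update_mono (fun j => ?_) (hG i) (by simpa [hi] using hFG i))
      by_cases hj : j ∈ s
      · simpa [hj] using hG j
      · simpa [hj] using hF j
  simpa using key Finset.univ

theorem lt_top [Fintype ι] (h : IsMultimeasure μ) {F : ∀ i, Set (Λ i)}
    (hF : ∀ i, MeasurableSet (F i)) : μ F < ∞ :=
  (h.mono hF (fun _ => .univ) fun _ => subset_univ _).trans_lt h.ne_top.lt_top

theorem eq_zero [Fintype ι] (h : IsMultimeasure μ) {F : ∀ i, Set (Λ i)}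
    (hF : ∀ i, MeasurableSet (F i)) {i : ι} (hi : F i = ∅) : μ F = 0 := by
  have e := h.add F hF i ∅ ∅ .empty .empty (disjoint_empty _)
  rw [union_empty, ← hi, Function.update_eq_self] at e
  have e' : μ F + 0 = μ F + μ F := by rw [add_zero, ← e]
  exact ((ENNReal.add_right_inj (h.lt_top hF).ne).mp e').symm

end Basic

/-- The family of sets on `Option α` with `none ↦ B` and `some a ↦ F a`. -/
def optionCons {α : Type*} {Λ : Option α → Type*} (B : Set (Λ none)) (F : ∀ a, Set (Λ (some a))) :
    ∀ i, Set (Λ i)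
  | none => B
  | some a => F a

theorem optionCons_update_some {α : Type*} [DecidableEq α] {Λ : Option α → Type*}
    (B : Set (Λ none)) (F : ∀ a, Set (Λ (some a))) (a : α) (A : Set (Λ (some a))) :
    optionCons B (Function.update F a A) = Function.update (optionCons B F) (some a) A := by
  funext i
  match i with
  | none => simp [optionCons]
  | some a' =>
    rcases eq_or_ne a' a with rfl | h
    · simp [optionCons]
    · simp [optionCons, h]

theorem update_none_optionCons {α : Type*} [DecidableEq α] {Λ : Option α → Type*}
    (B B' : Set (Λ none)) (F : ∀ a, Set (Λ (some a))) :
    Function.update (optionCons B F) none B' = optionCons B' F := by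
  funext i
  match i with
  | none => simp [optionCons]
  | some a' => simp [optionCons]

theorem optionCons_univ {α : Type*} {Λ : Option α → Type*} :
    optionCons (univ : Set (Λ none)) (fun _ => univ) = fun _ => univ := by
  funext i
  match i with
  | none => rfl
  | some a' => rfl

theorem measurableSet_optionCons {α : Type*} {Λ : Option α → Type*}
    [∀ i, MeasurableSpace (Λ i)] {B : Set (Λ none)} (hB : MeasurableSet B)
    {F : ∀ a, Set (Λ (some a))} (hF : ∀ a, MeasurableSet (F a)) :
    ∀ i, MeasurableSet (optionCons B F i)
  | none => hB
  | some a => hF a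

/-- With the side `B` at `none` held fixed, the induction hypothesis provides a measure `β B` on the
other factors. The family `β` is a bimeasure, and its kernel `κ` yields the extension `β univ ⊗ₘ κ`,
up to reordering coordinates. -/
theorem exists_measure_option {α : Type*} [Fintype α] [DecidableEq α] {Λ : Option α → Type*}
    [∀ i, MeasurableSpace (Λ i)] [StandardBorelSpace (Λ none)] {μ : (∀ i, Set (Λ i)) → ℝ≥0∞}
    (h : IsMultimeasure μ)
    (ih : ∀ μ' : (∀ a, Set (Λ (some a))) → ℝ≥0∞, IsMultimeasure μ' →
      ∃ m : Measure (∀ a, Λ (some a)), ∀ F, (∀ a, MeasurableSet (F a)) → m (univ.pi F) = μ' F) :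
    ∃ m : Measure (∀ i, Λ i), ∀ F, (∀ i, MeasurableSet (F i)) → m (univ.pi F) = μ F := by
  -- A Markov kernel needs a nonempty target; over an empty factor every rectangle has an empty side
  -- and `μ` vanishes.
  rcases isEmpty_or_nonempty (Λ none) with hempty | hne
  · refine ⟨0, fun F hF => ?_⟩
    rw [h.eq_zero hF (i := none) (eq_empty_of_isEmpty _)]
    simp
  have hμ' : ∀ B, MeasurableSet B → IsMultimeasure fun F => μ (optionCons B F) := by
    intro B hB
    refine ⟨(h.lt_top (measurableSet_optionCons hB fun _ => .univ)).ne, ?_, ?_⟩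
    · intro F hF a A A' hA hA' hAA'
      simp only [optionCons_update_some]
      exact h.add _ (measurableSet_optionCons hB hF) _ _ _ hA hA' hAA'
    · intro a D hD hmono hDe
      -- Restricting the side at `none` to `B` only decreases the marginal, so continuity at `∅` is
      -- inherited.
      refine tendsto_of_tendsto_of_tendsto_of_le_of_le tendsto_const_nhds
        (h.tendsto (some a) D hD hmono hDe) (fun _ => zero_le) (fun k => ?_)
      simp only [optionCons_update_some]
      rw [← optionCons_univ]
      refine h.mono (measurableSet_update (measurableSet_optionCons hB fun _ => .univ) (hD k))
        (measurableSet_update (measurableSet_optionCons .univ fun _ => .univ) (hD k)) fun i => ?_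
      rcases eq_or_ne i (some a) with rfl | hi
      · simp
      · simp only [Function.update_of_ne hi]
        match i with
        | none => exact subset_univ _
        | some _ => exact le_rfl
  choose! β hβ using fun B hB => ih _ (hμ' B hB)
  have huniv : ∀ B, MeasurableSet B → β B univ = μ (optionCons B fun _ => univ) := by
    intro B hB
    rw [← hβ B hB _ fun _ => .univ, pi_univ]
  have hfin : ∀ B, MeasurableSet B → IsFiniteMeasure (β B) := fun B hB =>
    ⟨by
      rw [huniv B hB]
      exact h.lt_top (measurableSet_optionCons hB fun _ => .univ)⟩
  have hbi : IsBimeasure β := by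
    refine ⟨hfin _ .univ, ?_, ?_⟩
    · intro A B hA hB hAB
      have := hfin _ (hA.union hB)
      refine measure_pi_ext fun F hF => ?_
      rw [Measure.add_apply, hβ _ hA _ hF, hβ _ hB _ hF, hβ _ (hA.union hB) _ hF]
      have e := h.add (optionCons univ F) (measurableSet_optionCons .univ hF) none A B hA hB hAB
      simpa only [update_none_optionCons] using e
    · intro D hD hmono hDe
      have e := h.tendsto none D hD hmono hDe
      rw [← optionCons_univ] at e
      simp only [update_none_optionCons] at e
      exact e.congr fun k => (huniv _ (hD k)).symm
  obtain ⟨κ, hκ, hκβ⟩ := hbi.exists_kernel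
  have := hbi.finite
  let f : (∀ a, Λ (some a)) × Λ none → ∀ i, Λ i := fun p i =>
    match i with
    | none => p.2
    | some a => p.1 a
  have hf : Measurable f := by
    refine measurable_pi_iff.mpr fun i => ?_
    match i with
    | none => exact measurable_snd
    | some a => exact (measurable_pi_apply a).comp measurable_fst
  refine ⟨(β univ ⊗ₘ κ).map f, fun F hF => ?_⟩
  have hpre : f ⁻¹' univ.pi F = (univ.pi fun a => F (some a)) ×ˢ F none := by
    ext p
    simp only [mem_preimage, mem_univ_pi, mem_prod, Option.forall, f]
    exact and_comm
  rw [Measure.map_apply hf (.univ_pi hF), hpre,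
    Measure.compProd_apply_prod (.univ_pi fun a => hF _) (hF none),
    hκβ _ (hF none) _ (.univ_pi fun a => hF _), hβ _ (hF none) _ fun a => hF _]
  congr 1
  funext i
  match i with
  | none => rfl
  | some a => rfl

theorem piCongrLeft_update {α β : Type*} [DecidableEq α] [DecidableEq β] (P : β → Type*)
    (e : α ≃ β) (F : ∀ a, P (e a)) (a : α) (A : P (e a)) :
    Equiv.piCongrLeft P e (Function.update F a A) =
      Function.update (Equiv.piCongrLeft P e F) (e a) A := by
  funext b
  obtain ⟨a', rfl⟩ := e.surjective b
  rw [Equiv.piCongrLeft_apply_apply]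
  rcases eq_or_ne a' a with rfl | h
  · simp
  · rw [Function.update_of_ne h, Function.update_of_ne (e.injective.ne h),
      Equiv.piCongrLeft_apply_apply]

theorem piCongrLeft_univ {α β : Type*} {Λ : β → Type*} (e : α ≃ β) :
    Equiv.piCongrLeft (fun b => Set (Λ b)) e (fun _ => univ) = fun _ => univ := by
  funext b
  obtain ⟨a, rfl⟩ := e.surjective b
  rw [Equiv.piCongrLeft_apply_apply]

/-- Relabelling invariance, required by the induction over finite index types. -/
theorem comp_piCongrLeft {α β : Type*} [DecidableEq α] [DecidableEq β] (e : α ≃ β)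
    {Λ : β → Type*} [∀ i, MeasurableSpace (Λ i)] {μ : (∀ i, Set (Λ i)) → ℝ≥0∞}
    (h : IsMultimeasure μ) :
    IsMultimeasure fun F : ∀ a, Set (Λ (e a)) =>
      μ (Equiv.piCongrLeft (fun b => Set (Λ b)) e F) := by
  refine ⟨by rw [piCongrLeft_univ]; exact h.ne_top, ?_, ?_⟩
  · intro F hF a A B hA hB hAB
    simp only [piCongrLeft_update]
    refine h.add _ (fun b => ?_) _ _ _ hA hB hAB
    obtain ⟨a, rfl⟩ := e.surjective b
    rw [Equiv.piCongrLeft_apply_apply]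
    exact hF a
  · intro a D hD hmono hDe
    simp only [piCongrLeft_update, piCongrLeft_univ]
    exact h.tendsto _ D hD hmono hDe

theorem exists_measure_congr {α β : Type*} [Fintype α] [Fintype β] [DecidableEq α]
    [DecidableEq β] (e : α ≃ β) {Λ : β → Type*}
    [∀ i, MeasurableSpace (Λ i)] {μ : (∀ i, Set (Λ i)) → ℝ≥0∞} (h : IsMultimeasure μ)
    (ih : ∀ μ' : (∀ a, Set (Λ (e a))) → ℝ≥0∞, IsMultimeasure μ' →
      ∃ m : Measure (∀ a, Λ (e a)), ∀ F, (∀ a, MeasurableSet (F a)) → m (univ.pi F) = μ' F) :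
    ∃ m : Measure (∀ i, Λ i), ∀ F, (∀ i, MeasurableSet (F i)) → m (univ.pi F) = μ F := by
  obtain ⟨m, hmμ⟩ := ih _ (h.comp_piCongrLeft e)
  refine ⟨m.map (MeasurableEquiv.piCongrLeft Λ e), fun F hF => ?_⟩
  rw [MeasurableEquiv.map_apply]
  have hpre : MeasurableEquiv.piCongrLeft Λ e ⁻¹' univ.pi F = univ.pi fun a => F (e a) := by
    ext x
    simp only [mem_preimage, mem_univ_pi, MeasurableEquiv.coe_piCongrLeft]
    refine ⟨fun hx a => ?_, fun hx b => ?_⟩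
    · simpa only [Equiv.piCongrLeft_apply_apply] using hx (e a)
    · obtain ⟨a, rfl⟩ := e.surjective b
      simpa only [Equiv.piCongrLeft_apply_apply] using hx a
  rw [hpre, hmμ _ fun a => hF _]
  congr 1
  funext b
  obtain ⟨a, rfl⟩ := e.surjective b
  rw [Equiv.piCongrLeft_apply_apply]

/-- A multimeasure on the rectangles of a finite product of standard Borel spaces extends to a
measure. -/
theorem exists_measure {ι : Type u} [Fintype ι] [dec : DecidableEq ι] {Λ : ι → Type v}
    [∀ i, MeasurableSpace (Λ i)] [∀ i, StandardBorelSpace (Λ i)]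
    {μ : (∀ i, Set (Λ i)) → ℝ≥0∞} (h : IsMultimeasure μ) :
    ∃ m : Measure (∀ i, Λ i), ∀ F, (∀ i, MeasurableSet (F i)) → m (univ.pi F) = μ F := by
  refine Fintype.induction_empty_option (P := fun ι _ => ∀ (dec : DecidableEq ι) (Λ : ι → Type v)
    [∀ i, MeasurableSpace (Λ i)] [∀ i, StandardBorelSpace (Λ i)]
    (μ : (∀ i, Set (Λ i)) → ℝ≥0∞), IsMultimeasure μ →
    ∃ m : Measure (∀ i, Λ i), ∀ F, (∀ i, MeasurableSet (F i)) → m (univ.pi F) = μ F)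
    ?_ ?_ ?_ ι dec Λ μ h
  · intro α β _ e ih dec Λ _ _ μ h
    classical
    have := Fintype.ofEquiv β e.symm
    exact exists_measure_congr e h fun μ' hμ' => ih _ _ μ' hμ'
  · intro dec Λ _ _ μ h
    -- An empty product is one point and has a single rectangle, so a scaled Dirac mass suffices.
    refine ⟨μ (fun _ => univ) • Measure.dirac fun i => i.elim, fun F hF => ?_⟩
    rw [Subsingleton.elim F fun _ => univ]
    simp
  · intro α _ ih dec Λ _ _ μ h
    classical
    obtain rfl : dec = Option.instDecidableEq := Subsingleton.elim _ _
    exact exists_measure_option h fun μ' hμ' => ih _ _ μ' hμ'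

/-- Multimeasures that agree on the rectangles with full side at `p` come from a common
probability measure on the remaining sides together with Markov kernels to the side at `p`. -/
theorem exists_kernels {ι : Type*} [Fintype ι] [DecidableEq ι] {Λ : ι → Type*}
    [∀ i, MeasurableSpace (Λ i)] [∀ i, StandardBorelSpace (Λ i)] (p : ι)
    {σ : Type*} [Nonempty σ] {μ : σ → (∀ i, Set (Λ i)) → ℝ≥0∞} (h : ∀ s, IsMultimeasure (μ s))
    (hone : ∀ s, μ s (fun _ => univ) = 1)
    (hindep : ∀ s t F, (∀ i, MeasurableSet (F i)) → F p = univ → μ s F = μ t F) :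
    ∃ (ν : Measure (∀ j : {i // i ≠ p}, Λ j)) (κ : σ → Kernel (∀ j : {i // i ≠ p}, Λ j) (Λ p)),
      IsProbabilityMeasure ν ∧ (∀ s, IsMarkovKernel (κ s)) ∧
      ∀ s F, (∀ i, MeasurableSet (F i)) →
        μ s F = ∫⁻ ω in univ.pi (fun j : {i // i ≠ p} => F j), κ s ω (F p) ∂ν := by
  choose m hm using fun s => (h s).exists_measure
  have hprob : ∀ s, IsProbabilityMeasure (m s) := fun s =>
    ⟨by rw [← hone s, ← hm s _ fun _ => .univ, pi_univ]⟩
  let f : (∀ i, Λ i) → (∀ j : {i // i ≠ p}, Λ j) × Λ p := fun ω => (fun j => ω j, ω p)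
  have hf : Measurable f := (measurable_pi_iff.mpr fun j => measurable_pi_apply _).prodMk
    (measurable_pi_apply p)
  obtain ⟨s₀⟩ := ‹Nonempty σ›
  have hprob' : ∀ s, IsProbabilityMeasure ((m s).map f) := fun s =>
    Measure.isProbabilityMeasure_map hf.aemeasurable
  have hne : Nonempty (Λ p) := by
    obtain ⟨ω⟩ := nonempty_of_isProbabilityMeasure (m s₀)
    exact ⟨ω p⟩
  -- Completes a rectangle on the remaining factors by the side `B` at `p`; the default `univ` at
  -- `p` is overwritten.
  let ext (F : ∀ j : {i // i ≠ p}, Set (Λ j)) (B : Set (Λ p)) : ∀ i, Set (Λ i) :=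
    Function.update (fun i => if hi : i ≠ p then F ⟨i, hi⟩ else univ) p B
  have hext : ∀ F B, (∀ j, MeasurableSet (F j)) → MeasurableSet B →
      ∀ i, MeasurableSet (ext F B i) := by
    intro F B hF hB
    refine measurableSet_update (fun i => ?_) hB
    by_cases hi : i ≠ p
    · simpa only [hi, dite_true, ne_eq, not_false_eq_true] using hF ⟨i, hi⟩
    · simp [hi]
  have hpre : ∀ F : ∀ i, Set (Λ i),
      f ⁻¹' ((univ.pi fun j : {i // i ≠ p} => F j) ×ˢ F p) = univ.pi F := by
    intro F
    ext ω
    simp only [mem_preimage, mem_prod, mem_univ_pi, f]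
    refine ⟨fun hω i => ?_, fun hω => ⟨fun j => hω j, hω p⟩⟩
    rcases eq_or_ne i p with rfl | hi
    · exact hω.2
    · exact hω.1 ⟨i, hi⟩
  have hmap : ∀ s F, (∀ i, MeasurableSet (F i)) →
      (m s).map f ((univ.pi fun j : {i // i ≠ p} => F j) ×ˢ F p) = μ s F := by
    intro s F hF
    rw [Measure.map_apply hf ((MeasurableSet.univ_pi fun j => hF _).prod (hF p)), hpre, hm s F hF]
  -- The marginals away from `p` are tested on rectangles with full side at `p`, where the `μ s`
  -- agree. One measure thus serves every `s`, and only the conditional kernels vary.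
  have hfst : ∀ s, ((m s).map f).fst = ((m s₀).map f).fst := by
    intro s
    refine measure_pi_ext fun F hF => ?_
    have hF' := hext F univ hF .univ
    have e1 := hmap s _ hF'
    have e2 := hmap s₀ _ hF'
    have e3 : (univ.pi fun j : {i // i ≠ p} => ext F univ j) = univ.pi F := by
      congr 1
      funext j
      simp [ext, j.2]
    have e4 : ext F univ p = univ := by simp [ext]
    rw [e3, e4, prod_univ] at e1 e2
    rw [Measure.fst_apply (.univ_pi hF), Measure.fst_apply (.univ_pi hF), e1, e2]
    exact hindep _ _ _ hF' e4
  refine ⟨((m s₀).map f).fst, fun s => ((m s).map f).condKernel, inferInstance,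
    fun s => inferInstance, fun s F hF => ?_⟩
  rw [← hmap s F hF, ← hfst s, ← Measure.compProd_apply_prod (.univ_pi fun j => hF _) (hF p),
    Measure.disintegrate]

end IsMultimeasure

end Multimeasure
/-! ### Traces of self-adjoint trace class operators -/

section TraceRepresentation

open Filter
open scoped Topology

variable {E : Type*} [NormedAddCommGroup E] [InnerProductSpace ℂ E]

theorem HilbertBasis.hasSum_norm_inner_sq {w : Type*} (b : HilbertBasis w ℂ E) (x : E) :
    HasSum (fun i => ‖⟪b i, x⟫_ℂ‖ ^ 2) (‖x‖ ^ 2) := by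
  have h := b.hasSum_inner_mul_inner x x
  rw [HilbertTensor.inner_self_eq_ofReal] at h
  refine Complex.hasSum_ofReal.mp (h.congr_fun fun i => ?_)
  rw [← inner_conj_symm x (b i), Complex.conj_mul']
  push_cast
  rfl

theorem HilbertBasis.summable_prod_norm_inner_sq {w w' : Type*} (b : HilbertBasis w ℂ E)
    (e : HilbertBasis w' ℂ E) {X : E →L[ℂ] E} (hX : Summable fun i => ‖X (b i)‖ ^ 2) :
    Summable fun p : w × w' => ‖⟪e p.2, X (b p.1)⟫_ℂ‖ ^ 2 := by
  refine (summable_prod_of_nonneg fun p => sq_nonneg _).mpr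
    ⟨fun i => (e.hasSum_norm_inner_sq (X (b i))).summable, ?_⟩
  exact hX.congr fun i => ((e.hasSum_norm_inner_sq (X (b i))).tsum_eq).symm

theorem summable_inner_apply {J : Type*} {v : J → E} (h : Summable fun j => ‖v j‖ ^ 2) (A : E →L[ℂ] E) :
    Summable fun j => ⟪v j, A (v j)⟫_ℂ := by
  refine Summable.of_norm_bounded (h.mul_left ‖A‖) fun j => ?_
  calc ‖⟪v j, A (v j)⟫_ℂ‖ ≤ ‖v j‖ * ‖A (v j)‖ := norm_inner_le_norm _ _
    _ ≤ ‖v j‖ * (‖A‖ * ‖v j‖) := by gcongr; exact A.le_opNorm _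
    _ = ‖A‖ * ‖v j‖ ^ 2 := by ring

variable [CompleteSpace E]

/-- Both sides are the double sum of `‖⟪e j, X (b i)⟫‖ ^ 2`, read in the two orders. For
self-adjoint `X` this makes the Hilbert–Schmidt condition independent of the basis. -/
theorem HilbertBasis.summable_norm_adjoint_sq {w w' : Type*} (b : HilbertBasis w ℂ E)
    (e : HilbertBasis w' ℂ E) {X : E →L[ℂ] E} (hX : Summable fun i => ‖X (b i)‖ ^ 2) :
    Summable fun j => ‖X.adjoint (e j)‖ ^ 2 := by
  have h := ((summable_prod_of_nonneg fun p => sq_nonneg _).mp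
    (b.summable_prod_norm_inner_sq e hX).prod_symm).2
  refine h.congr fun j => ?_
  rw [← (b.hasSum_norm_inner_sq (X.adjoint (e j))).tsum_eq]
  refine tsum_congr fun i => ?_
  rw [Prod.swap, ContinuousLinearMap.adjoint_inner_right, norm_inner_symm]

/-- The matrix coefficients form an absolutely summable double family, because `|ab| ≤ a² + b²`;
Parseval identifies its two iterated sums. -/
theorem HilbertBasis.exists_hasSum_inner_adjoint {w w' : Type*} (b : HilbertBasis w ℂ E)
    (e : HilbertBasis w' ℂ E) {X Y : E →L[ℂ] E} (hX : Summable fun i => ‖X (b i)‖ ^ 2)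
    (hY : Summable fun i => ‖Y (b i)‖ ^ 2) :
    ∃ t, HasSum (fun i => ⟪X (b i), Y (b i)⟫_ℂ) t ∧
      HasSum (fun j => ⟪Y.adjoint (e j), X.adjoint (e j)⟫_ℂ) t := by
  have hs : Summable fun p : w × w' => ⟪X (b p.1), e p.2⟫_ℂ * ⟪e p.2, Y (b p.1)⟫_ℂ := by
    refine Summable.of_norm_bounded
      ((b.summable_prod_norm_inner_sq e hX).add (b.summable_prod_norm_inner_sq e hY)) fun p => ?_
    rw [norm_mul, norm_inner_symm]
    nlinarith [sq_nonneg (‖⟪e p.2, X (b p.1)⟫_ℂ‖ - ‖⟪e p.2, Y (b p.1)⟫_ℂ‖),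
      sq_nonneg (‖⟪e p.2, X (b p.1)⟫_ℂ‖), sq_nonneg (‖⟪e p.2, Y (b p.1)⟫_ℂ‖)]
  refine ⟨_, hs.hasSum.prod_fiberwise fun i => e.hasSum_inner_mul_inner (X (b i)) (Y (b i)), ?_⟩
  refine ((Equiv.prodComm w' w).hasSum_iff.mpr hs.hasSum).prod_fiberwise fun j => ?_
  refine (b.hasSum_inner_mul_inner (Y.adjoint (e j)) (X.adjoint (e j))).congr_fun fun i => ?_
  simp only [Function.comp, Equiv.prodComm_apply, Prod.swap]
  rw [ContinuousLinearMap.adjoint_inner_left, ContinuousLinearMap.adjoint_inner_right, mul_comm]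

/-- `T` is represented by the square summable families `v` and `v'` as
`∑ j, |v j⟩⟨v j| - ∑ j, |v' j⟩⟨v' j|`, compatibly with traces. -/
structure IsTraceRepresentation {J : Type*} (T : E →L[ℂ] E) (v v' : J → E) : Prop where
  summable : Summable fun j => ‖v j‖ ^ 2
  summable' : Summable fun j => ‖v' j‖ ^ 2
  opTrace_comp : ∀ A : E →L[ℂ] E,
    opTrace (T ∘L A) = ∑' j, ⟪v j, A (v j)⟫_ℂ - ∑' j, ⟪v' j, A (v' j)⟫_ℂ
  inner_self : ∀ x, ⟪x, T x⟫_ℂ = ((∑' j, ‖⟪x, v j⟫_ℂ‖ ^ 2 - ∑' j, ‖⟪x, v' j⟫_ℂ‖ ^ 2 : ℝ) : ℂ)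

theorem ContinuousLinearMap.IsPositive.norm_sqrt_apply_sq {P : E →L[ℂ] E} (hP : P.IsPositive)
    (x : E) : ((‖CFC.sqrt P x‖ ^ 2 : ℝ) : ℂ) = ⟪x, P x⟫_ℂ := by
  have hP' := P.nonneg_iff_isPositive.mpr hP
  have hC : (CFC.sqrt P).IsPositive :=
    (CFC.sqrt P).nonneg_iff_isPositive.mp (CFC.sqrt_nonneg P)
  rw [← HilbertTensor.inner_self_eq_ofReal, hC.inner_left_eq_inner_right]
  have e := CFC.sqrt_mul_sqrt_self P hP'
  rw [← mul_apply_eq_comp, e]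

/-- Cyclicity of the trace for `P = C²`: both `C` and `C A` are Hilbert–Schmidt, the latter as the
adjoint of `A† C`. The basis `b` witnesses the trace class property, `e` labels the vectors of the
representation, and `e'` is the basis in which the trace is evaluated. -/
theorem ContinuousLinearMap.IsPositive.exists_hasSum_trace {w w' w'' : Type*} {P : E →L[ℂ] E}
    (hP : P.IsPositive) (b : HilbertBasis w ℂ E) (e : HilbertBasis w' ℂ E)
    (e' : HilbertBasis w'' ℂ E) (hb : Summable fun i => (⟪b i, P (b i)⟫_ℂ).re) :
    (Summable fun j => ‖CFC.sqrt P (e j)‖ ^ 2) ∧ ∀ A : E →L[ℂ] E,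
      ∃ t, HasSum (fun i => ⟪e' i, P (A (e' i))⟫_ℂ) t ∧
        HasSum (fun j => ⟪CFC.sqrt P (e j), A (CFC.sqrt P (e j))⟫_ℂ) t := by
  set C := CFC.sqrt P with hC
  have hCp : C.IsPositive := C.nonneg_iff_isPositive.mp (CFC.sqrt_nonneg P)
  have hadj : C.adjoint = C := hCp.isSelfAdjoint
  have hCC : ∀ x, C (C x) = P x := fun x =>
    congrArg (fun f : E →L[ℂ] E => f x)
      (CFC.sqrt_mul_sqrt_self P (P.nonneg_iff_isPositive.mpr hP))
  have hCb : Summable fun i => ‖C (b i)‖ ^ 2 := hb.congr fun i => by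
    rw [← hP.norm_sqrt_apply_sq, Complex.ofReal_re]
  refine ⟨by simpa only [hadj] using b.summable_norm_adjoint_sq e hCb, fun A => ?_⟩
  have hCe' : Summable fun j => ‖C (e' j)‖ ^ 2 := by
    simpa only [hadj] using b.summable_norm_adjoint_sq e' hCb
  have hAC : Summable fun j => ‖(A.adjoint ∘L C) (b j)‖ ^ 2 := by
    refine Summable.of_nonneg_of_le (fun _ => sq_nonneg _) (fun j => ?_)
      (hCb.mul_left (‖A.adjoint‖ ^ 2))
    rw [← mul_pow]
    exact pow_le_pow_left₀ (norm_nonneg _) (A.adjoint.le_opNorm _) 2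
  have hCA : Summable fun j => ‖(C ∘L A) (e' j)‖ ^ 2 := by
    have h := b.summable_norm_adjoint_sq e' hAC
    rwa [ContinuousLinearMap.adjoint_comp, ContinuousLinearMap.adjoint_adjoint, hadj] at h
  obtain ⟨t, h1, h2⟩ := e'.exists_hasSum_inner_adjoint e hCe' hCA
  refine ⟨t, h1.congr_fun fun i => ?_, h2.congr_fun fun j => ?_⟩
  · rw [hCp.inner_left_eq_inner_right, ContinuousLinearMap.comp_apply, hCC]
  · rw [ContinuousLinearMap.adjoint_comp, hadj, ContinuousLinearMap.comp_apply,
      ContinuousLinearMap.adjoint_inner_left]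

/-- A self-adjoint trace class operator is a difference of two sums of rank one operators. -/
theorem IsTraceClass.exists_representation {T : E →L[ℂ] E} (hT : IsTraceClass T)
    (hsa : IsSelfAdjoint T) : ∃ (w : Set E) (v v' : w → E), IsTraceRepresentation T v v' := by
  obtain ⟨w, b, hb⟩ := hT
  have hp : (T⁺).IsPositive := (T⁺).nonneg_iff_isPositive.mp (CFC.posPart_nonneg T)
  have hn : (T⁻).IsPositive := (T⁻).nonneg_iff_isPositive.mp (CFC.negPart_nonneg T)
  have hsub : T⁺ - T⁻ = T := CFC.posPart_sub_negPart T hsa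
  -- Since `|T| = T⁺ + T⁻`, the diagonal of `|T|` dominates those of both parts.
  rw [← CFC.posPart_add_negPart T hsa] at hb
  have hbp : Summable fun i => (⟪b i, T⁺ (b i)⟫_ℂ).re :=
    Summable.of_nonneg_of_le (fun i => hp.re_inner_nonneg_right (b i)) (fun i => by
      have := hn.re_inner_nonneg_right (b i)
      simp only [RCLike.re_to_complex] at this
      rw [add_apply, inner_add_right, Complex.add_re]
      linarith) hb
  have hbn : Summable fun i => (⟪b i, T⁻ (b i)⟫_ℂ).re :=
    Summable.of_nonneg_of_le (fun i => hn.re_inner_nonneg_right (b i)) (fun i => by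
      have := hp.re_inner_nonneg_right (b i)
      simp only [RCLike.re_to_complex] at this
      rw [add_apply, inner_add_right, Complex.add_re]
      linarith) hb
  -- This is the basis fixed in the definition of `opTrace`.
  let e := (exists_hilbertBasis ℂ E).choose_spec.choose
  obtain ⟨hsp, hep⟩ := hp.exists_hasSum_trace b b e hbp
  obtain ⟨hsn, hen⟩ := hn.exists_hasSum_trace b b e hbn
  refine ⟨w, fun j => CFC.sqrt T⁺ (b j), fun j => CFC.sqrt T⁻ (b j), hsp, hsn, fun A => ?_,
    fun x => ?_⟩
  · obtain ⟨t, h1, h2⟩ := hep A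
    obtain ⟨t', h1', h2'⟩ := hen A
    rw [h2.tsum_eq, h2'.tsum_eq]
    refine ((h1.sub h1').congr_fun fun i => ?_).tsum_eq
    rw [← inner_sub_right, ← sub_apply, hsub]
    rfl
  · have key : ∀ {P : E →L[ℂ] E}, P.IsPositive →
        ⟪x, P x⟫_ℂ = ((∑' j, ‖⟪x, CFC.sqrt P (b j)⟫_ℂ‖ ^ 2 : ℝ) : ℂ) := by
      intro P hP
      have hC : (CFC.sqrt P).IsPositive :=
        (CFC.sqrt P).nonneg_iff_isPositive.mp (CFC.sqrt_nonneg P)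
      rw [← hP.norm_sqrt_apply_sq, ← (b.hasSum_norm_inner_sq (CFC.sqrt P x)).tsum_eq]
      refine congrArg _ (tsum_congr fun j => ?_)
      rw [← hC.inner_left_eq_inner_right, norm_inner_symm]
    rw [Complex.ofReal_sub, ← key hp, ← key hn, ← inner_sub_right,
      ← sub_apply, hsub]

namespace IsTraceRepresentation

variable {J : Type*} {T : E →L[ℂ] E} {v v' : J → E}

theorem opTrace_comp_add (h : IsTraceRepresentation T v v') (A B : E →L[ℂ] E) :
    opTrace (T ∘L (A + B)) = opTrace (T ∘L A) + opTrace (T ∘L B) := by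
  simp only [h.opTrace_comp, add_apply, inner_add_right]
  rw [(summable_inner_apply h.summable A).tsum_add (summable_inner_apply h.summable B),
    (summable_inner_apply h.summable' A).tsum_add (summable_inner_apply h.summable' B)]
  ring

/-- Dominated convergence with majorant `‖v j‖ ^ 2`; bounded strong convergence of `A k` is enough.
-/
theorem tendsto_opTrace_comp (h : IsTraceRepresentation T v v') {A : ℕ → E →L[ℂ] E}
    (hnorm : ∀ k, ‖A k‖ ≤ 1) (hlim : ∀ x, Tendsto (fun k => A k x) atTop (𝓝 0)) :
    Tendsto (fun k => opTrace (T ∘L A k)) atTop (𝓝 0) := by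
  have key : ∀ {v : J → E}, (Summable fun j => ‖v j‖ ^ 2) →
      Tendsto (fun k => ∑' j, ⟪v j, A k (v j)⟫_ℂ) atTop (𝓝 0) := by
    intro v hv
    have := tendsto_tsum_of_dominated_convergence (𝓕 := atTop)
      (f := fun k j => ⟪v j, A k (v j)⟫_ℂ) (g := fun _ => 0) hv
      (fun j => by simpa using (hlim (v j)).inner (𝕜 := ℂ) (tendsto_const_nhds (x := v j)) |>.star)
      (Eventually.of_forall fun k j => by
        calc ‖⟪v j, A k (v j)⟫_ℂ‖ ≤ ‖v j‖ * ‖A k (v j)‖ := norm_inner_le_norm _ _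
          _ ≤ ‖v j‖ * (1 * ‖v j‖) := by
            gcongr
            exact (A k).le_of_opNorm_le (hnorm k) _
          _ = ‖v j‖ ^ 2 := by ring)
    simpa using this
  simp only [h.opTrace_comp]
  simpa using (key h.summable).sub (key h.summable')

/-- Positivity of the trace against `B * B` for a self-adjoint `B`, tested on the images under `B`
of a complete orthonormal system. -/
theorem opTrace_comp_nonneg (h : IsTraceRepresentation T v v') {w : Type*}
    (e : HilbertBasis w ℂ E) {A B : E →L[ℂ] E} (hB : IsSelfAdjoint B) (hA : A = B ∘L B)
    (hpos : ∀ i, 0 ≤ ⟪B (e i), T (B (e i))⟫_ℂ) : 0 ≤ opTrace (T ∘L A) := by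
  have hBB : ∀ x y, ⟪B x, y⟫_ℂ = ⟪x, B y⟫_ℂ := fun x y => by
    rw [← ContinuousLinearMap.adjoint_inner_right, ← ContinuousLinearMap.star_eq_adjoint,
      hB.star_eq]
  have key : ∀ {v : J → E}, (Summable fun j => ‖v j‖ ^ 2) →
      (∑' j, ⟪v j, A (v j)⟫_ℂ = ((∑' i, ∑' j, ‖⟪B (e i), v j⟫_ℂ‖ ^ 2 : ℝ) : ℂ)) ∧
      Summable fun i => ∑' j, ‖⟪B (e i), v j⟫_ℂ‖ ^ 2 := by
    intro v hv
    have hs : Summable fun p : J × w => ‖⟪B (e p.2), v p.1⟫_ℂ‖ ^ 2 := by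
      refine (summable_prod_of_nonneg fun p => sq_nonneg _).mpr ⟨fun j => ?_, ?_⟩
      · simpa only [hBB] using (e.hasSum_norm_inner_sq (B (v j))).summable
      · simp only [hBB, (e.hasSum_norm_inner_sq (B (v _))).tsum_eq]
        refine Summable.of_nonneg_of_le (fun _ => sq_nonneg _) (fun j => ?_)
          (hv.mul_left (‖B‖ ^ 2))
        rw [← mul_pow]
        exact pow_le_pow_left₀ (norm_nonneg _) (B.le_opNorm _) 2
    refine ⟨?_, ((summable_prod_of_nonneg fun p => sq_nonneg _).mp hs.prod_symm).2⟩
    rw [hs.tsum_comm (f := fun j i => ‖⟪B (e i), v j⟫_ℂ‖ ^ 2), Complex.ofReal_tsum]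
    refine tsum_congr fun j => ?_
    simp only [hBB]
    rw [(e.hasSum_norm_inner_sq (B (v j))).tsum_eq, hA, ContinuousLinearMap.comp_apply, ← hBB,
      HilbertTensor.inner_self_eq_ofReal]
  -- After the interchange of sums, the `i`-th term is `⟪B (e i), T (B (e i))⟫`, known to be
  -- nonnegative.
  rw [h.opTrace_comp, (key h.summable).1, (key h.summable').1, ← Complex.ofReal_sub,
    ← (key h.summable).2.tsum_sub (key h.summable').2]
  refine Complex.zero_le_real.mpr (tsum_nonneg fun i => ?_)
  have := hpos i
  rw [h.inner_self] at this
  exact Complex.zero_le_real.mp this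

end IsTraceRepresentation

end TraceRepresentation
/-! ### Product vectors and tensor products of operators -/

section TensorLemmas

open Filter
open scoped Topology

variable {ι : Type*} [Fintype ι] {G : ι → Type*} [∀ i, NormedAddCommGroup (G i)]
  [∀ i, InnerProductSpace ℂ (G i)]

theorem norm_productVector (x : ∀ i, G i) : ‖productVector x‖ = ∏ i, ‖x i‖ := by
  have h := inner_productVector x x
  simp only [HilbertTensor.inner_self_eq_ofReal] at h
  rw [← Complex.ofReal_prod, Complex.ofReal_inj, Finset.prod_pow] at h
  exact (sq_eq_sq₀ (norm_nonneg _) (Finset.prod_nonneg fun i _ => norm_nonneg _)).mp h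

theorem productVector_update_add [DecidableEq ι] (x : ∀ i, G i) (i : ι) (a b : G i) :
    productVector (Function.update x i (a + b)) =
      productVector (Function.update x i a) + productVector (Function.update x i b) := by
  rw [productVector, productVector, productVector, ← UniformSpace.Completion.coe_add]
  exact congrArg _ ((PiTensorProduct.tprod ℂ).map_update_add x i a b)

theorem productVector_update_smul [DecidableEq ι] (x : ∀ i, G i) (i : ι) (c : ℂ) (a : G i) :
    productVector (Function.update x i (c • a)) =
      c • productVector (Function.update x i a) := by
  rw [productVector, productVector, ← UniformSpace.Completion.coe_smul]
  exact congrArg _ ((PiTensorProduct.tprod ℂ).map_update_smul x i c a)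

/-- The product vector as a continuous linear function of its factor at `i`. -/
noncomputable def productVectorUpdate [DecidableEq ι] (x : ∀ i, G i) (i : ι) : G i →L[ℂ] HilbertTensor G :=
  LinearMap.mkContinuous
    { toFun := fun a => productVector (Function.update x i a)
      map_add' := productVector_update_add x i
      map_smul' := productVector_update_smul x i }
    (∏ j ∈ Finset.univ.erase i, ‖x j‖) fun a => by
      simp only [LinearMap.coe_mk, AddHom.coe_mk]
      rw [norm_productVector, ← Finset.mul_prod_erase Finset.univ _ (Finset.mem_univ i),
        Function.update_self, mul_comm]
      refine le_of_eq (congrArg (· * ‖a‖) (Finset.prod_congr rfl fun j hj => ?_))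
      rw [Function.update_of_ne (Finset.ne_of_mem_erase hj)]

theorem productVectorUpdate_apply [DecidableEq ι] (x : ∀ i, G i) (i : ι) (a : G i) :
    productVectorUpdate x i a = productVector (Function.update x i a) := rfl

/-- Finite combinations of product vectors are the algebraic tensor product, which is dense in its
completion. -/
theorem eq_top_of_productVector_mem {K : Submodule ℂ (HilbertTensor G)}
    (hK : IsClosed (K : Set (HilbertTensor G))) (h : ∀ x, productVector x ∈ K) : K = ⊤ := by
  refine (Submodule.eq_top_iff'.mpr fun z => ?_)
  induction z using UniformSpace.Completion.induction_on with
  | hp => exact hK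
  | ih t =>
    obtain ⟨c, hc⟩ := HilbertTensor.exists_finsupp (G := G) t
    have e : (t : HilbertTensor G) = ∑ x ∈ c.support, c x • productVector x := by
      rw [hc]
      exact (map_sum (UniformSpace.Completion.toComplL (𝕜 := ℂ) (E := HilbertTensor.Algebraic G))
        (fun x => c x • HilbertTensor.elementary x) c.support).trans
        (Finset.sum_congr rfl fun x _ => map_smul _ _ _)
    rw [e]
    exact Submodule.sum_mem _ fun x _ => K.smul_mem _ (h x)

theorem HilbertTensor.ext_productVector {F : Type*} [NormedAddCommGroup F] [NormedSpace ℂ F]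
    {A B : HilbertTensor G →L[ℂ] F} (h : ∀ x, A (productVector x) = B (productVector x)) :
    A = B := by
  have hK := eq_top_of_productVector_mem (K := LinearMap.eqLocus A.toLinearMap B.toLinearMap)
    (isClosed_eq A.continuous B.continuous) h
  exact ContinuousLinearMap.ext fun z => by
    have : z ∈ LinearMap.eqLocus A.toLinearMap B.toLinearMap := hK ▸ Submodule.mem_top
    exact this

theorem tensorOperator_comp (A B : ∀ i, G i →L[ℂ] G i) :
    tensorOperator (fun i => A i ∘L B i) = tensorOperator A ∘L tensorOperator B :=
  HilbertTensor.ext_productVector fun x => by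
    simp only [ContinuousLinearMap.comp_apply, tensorOperator_productVector]

theorem tensorOperator_id :
    tensorOperator (fun i => ContinuousLinearMap.id ℂ (G i)) = ContinuousLinearMap.id ℂ _ :=
  HilbertTensor.ext_productVector fun x => by
    simp only [tensorOperator_productVector, ContinuousLinearMap.id_apply]

theorem tensorOperator_update_productVector [DecidableEq ι] (A : ∀ i, G i →L[ℂ] G i) (i : ι)
    (B : G i →L[ℂ] G i) (x : ∀ i, G i) :
    tensorOperator (Function.update A i B) (productVector x) =
      productVectorUpdate (fun j => A j (x j)) i (B (x i)) := by
  rw [tensorOperator_productVector, productVectorUpdate_apply]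
  congr 1
  funext j
  rcases eq_or_ne j i with rfl | h
  · simp
  · simp [h]

theorem tensorOperator_update_add [DecidableEq ι] (A : ∀ i, G i →L[ℂ] G i) (i : ι)
    (B C : G i →L[ℂ] G i) :
    tensorOperator (Function.update A i (B + C)) =
      tensorOperator (Function.update A i B) + tensorOperator (Function.update A i C) :=
  HilbertTensor.ext_productVector fun x => by
    simp only [add_apply, tensorOperator_update_productVector, map_add]

theorem norm_tensorOperator_le (A : ∀ i, G i →L[ℂ] G i) :
    ‖tensorOperator A‖ ≤ ∏ i, ‖A i‖ := by
  refine ContinuousLinearMap.opNorm_le_bound _ (Finset.prod_nonneg fun _ _ => norm_nonneg _)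
    fun z => ?_
  induction z using UniformSpace.Completion.induction_on with
  | hp => exact isClosed_le (by fun_prop) (by fun_prop)
  | ih t =>
    rw [tensorOperator, ContinuousLinearMap.completion_apply_coe,
      UniformSpace.Completion.norm_coe, UniformSpace.Completion.norm_coe]
    exact HilbertTensor.norm_map_le A t

/-- By the uniform norm bound, the vectors `z` where convergence holds form a closed subspace. It
contains the product vectors, which depend continuously on each factor. -/
theorem tendsto_tensorOperator_update [DecidableEq ι] {A : ∀ i, G i →L[ℂ] G i} {i : ι}
    {B : ℕ → G i →L[ℂ] G i} (hA : ∀ j, ‖A j‖ ≤ 1) (hB : ∀ k, ‖B k‖ ≤ 1)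
    (hlim : ∀ x, Tendsto (fun k => B k x) atTop (𝓝 0)) (z : HilbertTensor G) :
    Tendsto (fun k => tensorOperator (Function.update A i (B k)) z) atTop (𝓝 0) := by
  have hnorm : ∀ k, ‖tensorOperator (Function.update A i (B k))‖ ≤ 1 := by
    intro k
    refine (norm_tensorOperator_le _).trans (Finset.prod_le_one (fun _ _ => norm_nonneg _) ?_)
    intro j _
    rcases eq_or_ne j i with rfl | h
    · simpa using hB k
    · simpa [h] using hA j
  let K : Submodule ℂ (HilbertTensor G) :=
    { carrier := {z | Tendsto (fun k => tensorOperator (Function.update A i (B k)) z) atTop (𝓝 0)}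
      add_mem' := fun {a b} ha hb => by simpa using Tendsto.add ha hb
      zero_mem' := by simp
      smul_mem' := fun c a ha => by simpa using Tendsto.const_smul ha c }
  have hK : K = ⊤ := by
    refine eq_top_of_productVector_mem ?_ fun x => ?_
    · refine isClosed_of_closure_subset fun z hz => Metric.tendsto_atTop.mpr fun ε hε => ?_
      obtain ⟨y, hy, hyz⟩ := Metric.mem_closure_iff.mp hz (ε / 2) (half_pos hε)
      obtain ⟨n, hn⟩ := Metric.tendsto_atTop.mp (show Tendsto _ _ _ from hy) (ε / 2) (half_pos hε)
      refine ⟨n, fun k hk => ?_⟩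
      have h1 := hn k hk
      rw [dist_zero_right] at h1 ⊢
      have h2 := ContinuousLinearMap.le_of_opNorm_le _ (hnorm k) (z - y)
      rw [← dist_eq_norm, one_mul, map_sub] at h2
      have h3 := norm_add_le (tensorOperator (Function.update A i (B k)) z -
        tensorOperator (Function.update A i (B k)) y) (tensorOperator (Function.update A i (B k)) y)
      rw [sub_add_cancel] at h3
      linarith
    · change Tendsto _ _ _
      simp only [tensorOperator_update_productVector]
      have := ((productVectorUpdate (fun j => A j (x j)) i).continuous.tendsto 0).comp (hlim (x i))
      rwa [map_zero] at this
  have hz : z ∈ K := hK ▸ Submodule.mem_top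
  exact hz

theorem isSelfAdjoint_tensorOperator [∀ i, CompleteSpace (G i)] {A : ∀ i, G i →L[ℂ] G i}
    (hA : ∀ i, IsSelfAdjoint (A i)) : IsSelfAdjoint (tensorOperator A) := by
  rw [ContinuousLinearMap.isSelfAdjoint_iff']
  refine HilbertTensor.ext_productVector fun x => ?_
  refine (innerSL_inj (𝕜 := ℂ)).mp (HilbertTensor.ext_productVector fun y => ?_)
  rw [innerSL_apply_apply, innerSL_apply_apply, ContinuousLinearMap.adjoint_inner_left,
    tensorOperator_productVector, tensorOperator_productVector, inner_productVector,
    inner_productVector]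
  refine Finset.prod_congr rfl fun i _ => ?_
  rw [← ContinuousLinearMap.adjoint_inner_left, ← ContinuousLinearMap.star_eq_adjoint,
    (hA i).star_eq]

/-- Products of complete orthonormal systems form a complete orthonormal system. -/
theorem exists_productBasis [∀ i, CompleteSpace (G i)] {w : ι → Type*}
    (b : ∀ i, HilbertBasis (w i) ℂ (G i)) :
    ∃ e : HilbertBasis (∀ i, w i) ℂ (HilbertTensor G),
      ∀ f, e f = productVector fun i => b i (f i) := by
  classical
  have hon : Orthonormal ℂ fun f : ∀ i, w i => productVector fun i => b i (f i) := by
    rw [orthonormal_iff_ite]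
    intro f g
    rw [inner_productVector]
    simp only [fun i => orthonormal_iff_ite.mp (b i).orthonormal (f i) (g i)]
    by_cases h : f = g
    · simp [h]
    · obtain ⟨i, hi⟩ := Function.ne_iff.mp h
      rw [if_neg h]
      exact Finset.prod_eq_zero (Finset.mem_univ i) (if_neg hi)
  set K := (Submodule.span ℂ
    (Set.range fun f : ∀ i, w i => productVector fun i => b i (f i))).topologicalClosure with hK
  -- Outside `s` the factors are basis vectors, inside `s` they are arbitrary. Each new index is
  -- freed by linearity, continuity and density of the span of `b i`.
  have key : ∀ (s : Finset ι) (x : ∀ i, G i), (∀ i ∉ s, x i ∈ Set.range (b i)) →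
      productVector x ∈ K := by
    intro s
    induction s using Finset.induction_on with
    | empty =>
      intro x hx
      choose f hf using fun i => hx i (Finset.notMem_empty i)
      exact Submodule.le_topologicalClosure _ (Submodule.subset_span ⟨f, by simp only [hf]⟩)
    | insert i s hi ih =>
      intro x hx
      have hle : (Submodule.span ℂ (Set.range (b i))).topologicalClosure ≤
          K.comap (productVectorUpdate x i).toLinearMap := by
        refine Submodule.topologicalClosure_minimal _ (Submodule.span_le.mpr ?_) ?_
        · rintro _ ⟨a, rfl⟩
          refine ih _ fun j hj => ?_
          rcases eq_or_ne j i with rfl | hji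
          · exact ⟨a, by simp⟩
          · simpa [hji] using hx j (by simp [hj, hji])
        · exact (Submodule.isClosed_topologicalClosure _).preimage
            (productVectorUpdate x i).continuous
      rw [(b i).dense_span] at hle
      have := hle (Submodule.mem_top (x := x i))
      rwa [Submodule.mem_comap, ContinuousLinearMap.coe_coe, productVectorUpdate_apply,
        Function.update_eq_self] at this
  have htop : K = ⊤ := eq_top_of_productVector_mem (Submodule.isClosed_topologicalClosure _)
    fun x => key Finset.univ x fun i hi => absurd (Finset.mem_univ i) hi
  exact ⟨HilbertBasis.mk hon htop.ge, fun f => by rw [HilbertBasis.coe_mk]⟩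

/-- The trace of a tensor positive operator times a product of positive operators is
nonnegative. -/
theorem TensorPositive.opTrace_comp_nonneg [∀ i, CompleteSpace (G i)]
    {T : HilbertTensor G →L[ℂ] HilbertTensor G} (hT : TensorPositive T) {J : Type*}
    {v v' : J → HilbertTensor G} (h : IsTraceRepresentation T v v') {A : ∀ i, G i →L[ℂ] G i}
    (hA : ∀ i, (A i).IsPositive) : 0 ≤ opTrace (T ∘L tensorOperator A) := by
  choose w b hb using fun i => exists_hilbertBasis ℂ (G i)
  obtain ⟨e, he⟩ := exists_productBasis b
  have hpos : ∀ i, (CFC.sqrt (A i)).IsPositive := fun i =>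
    (CFC.sqrt (A i)).nonneg_iff_isPositive.mp (CFC.sqrt_nonneg (A i))
  -- The tensor product of the square roots maps product basis vectors to product vectors, exactly
  -- where tensor positivity applies.
  refine h.opTrace_comp_nonneg e (B := tensorOperator fun i => CFC.sqrt (A i))
    (isSelfAdjoint_tensorOperator fun i => (hpos i).isSelfAdjoint) ?_ fun f => ?_
  · rw [← tensorOperator_comp]
    congr 1
    funext i
    exact (CFC.sqrt_mul_sqrt_self (A i) ((A i).nonneg_iff_isPositive.mpr (hA i))).symm
  · rw [he, tensorOperator_productVector]
    exact hT _

end TensorLemmas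

/-! ### Positive operator-valued measures -/

namespace POVM

open Filter
open scoped Topology ENNReal

variable {Λ : Type*} [MeasurableSpace Λ] {E : Type*} [NormedAddCommGroup E]
  [InnerProductSpace ℂ E] (M : POVM Λ E)

theorem inner_effect_empty (ψ : E) : ⟪ψ, M.effect ∅ ψ⟫_ℂ = 0 := by
  have h := M.hasSum_iUnion (fun _ => ∅) (fun _ => .empty)
    (fun i j _ => Set.disjoint_empty _) ψ
  by_contra h0
  -- A constant series over `ℕ` converges only if the constant is zero.
  have := (summable_const_iff _).mp h.summable
  exact h0 this

/-- The outcome distribution of a POV measure in the vector state `ψ` (not normalized). -/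
noncomputable def vectorMeasure (ψ : E) : Measure Λ :=
  Measure.ofMeasurable (fun F _ => ENNReal.ofReal (⟪ψ, M.effect F ψ⟫_ℂ).re)
    (by rw [M.inner_effect_empty]; simp)
    (fun F hF hdisj => by
      have h := Complex.hasSum_re (M.hasSum_iUnion F hF hdisj ψ)
      rw [← h.tsum_eq, ENNReal.ofReal_tsum_of_nonneg (f := fun i => (⟪ψ, M.effect (F i) ψ⟫_ℂ).re)
        (fun i => (M.isPositive _ (hF i)).re_inner_nonneg_right ψ) h.summable])

theorem vectorMeasure_apply (ψ : E) {F : Set Λ} (hF : MeasurableSet F) :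
    M.vectorMeasure ψ F = ENNReal.ofReal (⟪ψ, M.effect F ψ⟫_ℂ).re :=
  Measure.ofMeasurable_apply F hF

theorem inner_effect_eq (ψ : E) {F : Set Λ} (hF : MeasurableSet F) :
    ⟪ψ, M.effect F ψ⟫_ℂ = ((M.vectorMeasure ψ F).toReal : ℂ) := by
  have h := (M.isPositive F hF).inner_nonneg_right ψ
  rw [M.vectorMeasure_apply ψ hF, ENNReal.toReal_ofReal (Complex.le_def.mp h).1]
  exact Complex.ext rfl (Complex.le_def.mp h).2.symm

theorem vectorMeasure_ne_top (ψ : E) {F : Set Λ} (hF : MeasurableSet F) :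
    M.vectorMeasure ψ F ≠ ∞ := by
  rw [M.vectorMeasure_apply ψ hF]
  exact ENNReal.ofReal_ne_top

/-- Over `ℂ` an operator is determined by its quadratic form, so weak additivity suffices. -/
theorem effect_union {A B : Set Λ} (hA : MeasurableSet A) (hB : MeasurableSet B)
    (hAB : Disjoint A B) : M.effect (A ∪ B) = M.effect A + M.effect B := by
  have h : (M.effect (A ∪ B)).toLinearMap = (M.effect A + M.effect B).toLinearMap := by
    refine (ext_inner_map _ _).mp fun ψ => ?_
    rw [← inner_conj_symm, ← inner_conj_symm _ ψ]
    congr 1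
    simp only [ContinuousLinearMap.coe_coe, add_apply, inner_add_right]
    rw [M.inner_effect_eq ψ (hA.union hB), M.inner_effect_eq ψ hA, M.inner_effect_eq ψ hB,
      measure_union hAB hB, ENNReal.toReal_add (M.vectorMeasure_ne_top ψ hA)
        (M.vectorMeasure_ne_top ψ hB)]
    push_cast
    rfl
  exact ContinuousLinearMap.coe_injective h

variable [CompleteSpace E]

theorem norm_effect_le_one {F : Set Λ} (hF : MeasurableSet F) : ‖M.effect F‖ ≤ 1 := by
  have h1 := (M.effect F).nonneg_iff_isPositive.mpr (M.isPositive F hF)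
  have h2 := (M.effect Fᶜ).nonneg_iff_isPositive.mpr (M.isPositive _ hF.compl)
  rw [CStarAlgebra.norm_le_one_iff_of_nonneg _ h1]
  have e := M.effect_union hF hF.compl disjoint_compl_right
  rw [Set.union_compl_self, M.effect_univ] at e
  change M.effect F ≤ ContinuousLinearMap.id ℂ E
  rw [e]
  exact le_add_of_nonneg_right h2

/-- The square root of an effect is also a contraction. The estimate upgrades weak convergence of
effects to zero to strong convergence. -/
theorem norm_effect_apply_sq_le {F : Set Λ} (hF : MeasurableSet F) (ψ : E) :
    ‖M.effect F ψ‖ ^ 2 ≤ (M.vectorMeasure ψ F).toReal := by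
  have hP := M.isPositive F hF
  have hC : (CFC.sqrt (M.effect F)).IsPositive :=
    (CFC.sqrt (M.effect F)).nonneg_iff_isPositive.mp (CFC.sqrt_nonneg _)
  have hCC := CFC.sqrt_mul_sqrt_self (M.effect F) ((M.effect F).nonneg_iff_isPositive.mpr hP)
  have hn : ‖CFC.sqrt (M.effect F)‖ ≤ 1 := by
    have h1 : ‖CFC.sqrt (M.effect F)‖ * ‖CFC.sqrt (M.effect F)‖ = ‖M.effect F‖ := by
      rw [← CStarRing.norm_star_mul_self, hC.isSelfAdjoint.star_eq, hCC]
    have h2 := M.norm_effect_le_one hF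
    nlinarith [norm_nonneg (CFC.sqrt (M.effect F))]
  have h3 : ‖M.effect F ψ‖ ≤ ‖CFC.sqrt (M.effect F) ψ‖ := by
    have e : M.effect F ψ = CFC.sqrt (M.effect F) (CFC.sqrt (M.effect F) ψ) := by
      rw [← mul_apply_eq_comp, hCC]
    rw [e]
    simpa using ContinuousLinearMap.le_of_opNorm_le _ hn (CFC.sqrt (M.effect F) ψ)
  have h4 : ‖CFC.sqrt (M.effect F) ψ‖ ^ 2 = (M.vectorMeasure ψ F).toReal := by
    have := hP.norm_sqrt_apply_sq ψ
    rw [M.inner_effect_eq ψ hF] at this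
    exact_mod_cast this
  rw [← h4]
  exact pow_le_pow_left₀ (norm_nonneg _) h3 2

theorem tendsto_effect_apply {D : ℕ → Set Λ} (hD : ∀ k, MeasurableSet (D k)) (hmono : Antitone D)
    (hempty : ⋂ k, D k = ∅) (ψ : E) :
    Tendsto (fun k => M.effect (D k) ψ) atTop (𝓝 0) := by
  have h := tendsto_measure_iInter_atTop (μ := M.vectorMeasure ψ)
    (fun k => (hD k).nullMeasurableSet) hmono ⟨0, M.vectorMeasure_ne_top ψ (hD 0)⟩
  rw [hempty, measure_empty] at h
  have h' := (ENNReal.tendsto_toReal ENNReal.zero_ne_top).comp h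
  rw [ENNReal.toReal_zero] at h'
  have h2 : Tendsto (fun k => ‖M.effect (D k) ψ‖ ^ 2) atTop (𝓝 0) :=
    tendsto_of_tendsto_of_tendsto_of_le_of_le tendsto_const_nhds h' (fun _ => sq_nonneg _)
      fun k => M.norm_effect_apply_sq_le (hD k) ψ
  have h3 := h2.sqrt
  simp only [Real.sqrt_sq (norm_nonneg _), Real.sqrt_zero] at h3
  exact tendsto_zero_iff_norm_tendsto_zero.mpr h3

end POVM
/-! ### Local hidden variable models -/

section JointDistribution

open Filter
open scoped Topology ENNReal

variable {ι : Type*} [Fintype ι] {G : ι → Type*} [∀ i, NormedAddCommGroup (G i)]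
  [∀ i, InnerProductSpace ℂ (G i)] {Λ : ι → Type*} [∀ i, MeasurableSpace (Λ i)]

/-- The joint distribution `F ↦ tr [T (⊗ i, M i (F i))]` on measurable rectangles. -/
noncomputable def jointDistribution (T : HilbertTensor G →L[ℂ] HilbertTensor G)
    (M : ∀ i, POVM (Λ i) (G i)) (F : ∀ i, Set (Λ i)) : ℝ≥0∞ :=
  ENNReal.ofReal (opTrace (T ∘L tensorOperator fun i => (M i).effect (F i))).re

theorem jointDistribution_univ (T : HilbertTensor G →L[ℂ] HilbertTensor G)
    (M : ∀ i, POVM (Λ i) (G i)) :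
    jointDistribution T M (fun _ => Set.univ) = ENNReal.ofReal (opTrace T).re := by
  simp only [jointDistribution, POVM.effect_univ, tensorOperator_id, ContinuousLinearMap.comp_id]

theorem effect_update {ι : Type*} {G : ι → Type*} [∀ i, NormedAddCommGroup (G i)]
    [∀ i, InnerProductSpace ℂ (G i)] {Λ : ι → Type*} [∀ i, MeasurableSpace (Λ i)]
    [DecidableEq ι] (M : ∀ i, POVM (Λ i) (G i)) (F : ∀ i, Set (Λ i)) (i : ι)
    (A : Set (Λ i)) : (fun j => (M j).effect (Function.update F i A j)) =
      Function.update (fun j => (M j).effect (F j)) i ((M i).effect A) :=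
  funext fun j => Function.apply_update (fun j => (M j).effect) F i A j

variable [∀ i, CompleteSpace (G i)] {T : HilbertTensor G →L[ℂ] HilbertTensor G}

/-- By tensor positivity the trace is real and nonnegative, so neither the real part nor
`ENNReal.ofReal` discards anything. -/
theorem opTrace_eq_jointDistribution (hpos : TensorPositive T) (hT : IsTraceClass T)
    (hsa : IsSelfAdjoint T) (M : ∀ i, POVM (Λ i) (G i)) {F : ∀ i, Set (Λ i)}
    (hF : ∀ i, MeasurableSet (F i)) :
    opTrace (T ∘L tensorOperator fun i => (M i).effect (F i)) =
      ((jointDistribution T M F).toReal : ℂ) := by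
  obtain ⟨_, _, _, h⟩ := hT.exists_representation hsa
  have h0 := Complex.le_def.mp (hpos.opTrace_comp_nonneg h fun i => (M i).isPositive _ (hF i))
  rw [jointDistribution, ENNReal.toReal_ofReal h0.1]
  exact Complex.ext rfl h0.2.symm

/-- Positivity makes `ENNReal.ofReal` additive on the traces in question; continuity at `∅` combines
strong convergence of the effects with dominated convergence of the trace. -/
theorem isMultimeasure_jointDistribution [DecidableEq ι] (hpos : TensorPositive T)
    (hT : IsTraceClass T) (hsa : IsSelfAdjoint T) (M : ∀ i, POVM (Λ i) (G i)) :
    IsMultimeasure (jointDistribution T M) := by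
  obtain ⟨_, _, _, h⟩ := hT.exists_representation hsa
  refine ⟨ENNReal.ofReal_ne_top, fun F hF i A B hA hB hAB => ?_, fun i D hD hmono hDe => ?_⟩
  · have hnn : ∀ C, MeasurableSet C → 0 ≤ (opTrace (T ∘L tensorOperator
        fun j => (M j).effect (Function.update F i C j))).re := fun C hC =>
      (Complex.le_def.mp (hpos.opTrace_comp_nonneg h fun j =>
        (M j).isPositive _ (measurableSet_update hF hC j))).1
    rw [jointDistribution, jointDistribution, jointDistribution,
      ← ENNReal.ofReal_add (hnn A hA) (hnn B hB), ← Complex.add_re, effect_update, effect_update,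
      effect_update, (M i).effect_union hA hB hAB, tensorOperator_update_add, h.opTrace_comp_add]
  · have hn : ∀ j, ‖(M j).effect Set.univ‖ ≤ 1 := fun j => (M j).norm_effect_le_one .univ
    have hlim := h.tendsto_opTrace_comp (A := fun k => tensorOperator
      (Function.update (fun j => (M j).effect Set.univ) i ((M i).effect (D k)))) (fun k => ?_)
      (tendsto_tensorOperator_update hn (fun k => (M i).norm_effect_le_one (hD k))
        ((M i).tendsto_effect_apply hD hmono hDe))
    · have := ENNReal.tendsto_ofReal ((Complex.continuous_re.tendsto 0).comp hlim)
      simp only [Complex.zero_re, ENNReal.ofReal_zero] at this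
      refine this.congr fun k => ?_
      rw [jointDistribution, effect_update]
      rfl
    · refine (norm_tensorOperator_le _).trans (Finset.prod_le_one (fun _ _ => norm_nonneg _) ?_)
      intro j _
      rcases eq_or_ne j i with rfl | hj
      · simpa using (M j).norm_effect_le_one (hD k)
      · simpa [hj] using hn j

end JointDistribution

/-! ### The hidden variable model built from compatible joint distributions. -/

section Model

open scoped ENNReal

variable {N : ℕ} {S S' : Fin N → ℕ} {n : Fin N}

/-- The copy of the `m`-th factor that is measured under the settings `s`: the copy `s m` for
`m ≠ n`, and the copy `k n` at the site `n`. -/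
def measuredCopy (hS : ∀ m, m ≠ n → S' m = S m) (k : ∀ m, Fin (S m)) (s : ∀ m, Fin (S' m))
    (m : Fin N) : Fin (S m) :=
  if h : m ≠ n then Fin.cast (hS m h) (s m) else k m

theorem measuredCopy_self (hS : ∀ m, m ≠ n → S' m = S m) (k : ∀ m, Fin (S m))
    (s : ∀ m, Fin (S' m)) : measuredCopy hS k s n = k n := by
  simp [measuredCopy]

theorem measuredCopy_of_ne (hS : ∀ m, m ≠ n → S' m = S m) (k : ∀ m, Fin (S m))
    (s : ∀ m, Fin (S' m)) {m : Fin N} (h : m ≠ n) :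
    measuredCopy hS k s m = Fin.cast (hS m h) (s m) := by
  simp [measuredCopy, h]

variable {Λ : Fin N → Type v}

/-- The rectangle with side `F m` at the measured copy of each factor, and full sides elsewhere. -/
def copyRectangle (k : ∀ m, Fin (S m)) (F : ∀ m, Set (Λ m)) (p : (m : Fin N) × Fin (S m)) :
    Set (Λ p.1) :=
  if p.2 = k p.1 then F p.1 else Set.univ

theorem copyRectangle_self (k : ∀ m, Fin (S m)) (F : ∀ m, Set (Λ m)) (m : Fin N) :
    copyRectangle k F ⟨m, k m⟩ = F m := if_pos rfl

variable [∀ n, MeasurableSpace (Λ n)]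

theorem measurableSet_copyRectangle (k : ∀ m, Fin (S m)) {F : ∀ m, Set (Λ m)}
    (hF : ∀ m, MeasurableSet (F m)) (p : (m : Fin N) × Fin (S m)) :
    MeasurableSet (copyRectangle k F p) := by
  rw [copyRectangle]
  split_ifs
  exacts [hF _, .univ]

/-- Joint distributions of one observable for each copy of each factor, which depend on the setting
at site `n` only through the observable at one copy of the `n`-th factor, give an LHV model. -/
theorem admitsLHVModel_of_multimeasures [∀ n, StandardBorelSpace (Λ n)]
    (hS : ∀ m, m ≠ n → S' m = S m) (k : ∀ m, Fin (S m)) [Nonempty (Fin (S' n))]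
    {μ : Fin (S' n) → (∀ p : (m : Fin N) × Fin (S m), Set (Λ p.1)) → ℝ≥0∞}
    (hμ : ∀ t, IsMultimeasure (μ t)) (hone : ∀ t, μ t (fun _ => Set.univ) = 1)
    (hindep : ∀ t t' F, (∀ p, MeasurableSet (F p)) → F ⟨n, k n⟩ = Set.univ → μ t F = μ t' F)
    {P : (∀ m, Fin (S' m)) → (∀ m, Set (Λ m)) → ℂ}
    (hP : ∀ s F, (∀ m, MeasurableSet (F m)) →
      P s F = ((μ (s n) (copyRectangle (measuredCopy hS k s) F)).toReal : ℂ)) :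
    AdmitsLHVModel P := by
  obtain ⟨ν, κ, hν, hκ, h⟩ := IsMultimeasure.exists_kernels
    (Λ := fun p : (m : Fin N) × Fin (S m) => Λ p.1) ⟨n, k n⟩ hμ hone hindep
  have hne : ∀ m, m ≠ n → ∀ j : Fin (S m), (⟨m, j⟩ : (m : Fin N) × Fin (S m)) ≠ ⟨n, k n⟩ :=
    fun m hm j e => hm (congrArg Sigma.fst e)
  let K : ∀ m, Fin (S' m) →
      Kernel (∀ p : {p : (m : Fin N) × Fin (S m) // p ≠ ⟨n, k n⟩}, Λ p.1.1) (Λ m) :=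
    Function.update (fun m t => if hm : m ≠ n then
      Kernel.deterministic (fun ω => ω ⟨⟨m, Fin.cast (hS m hm) t⟩, hne m hm _⟩)
        (measurable_pi_apply _) else 0) n κ
  have hKn : K n = κ := Function.update_self ..
  have hKm : ∀ m (hm : m ≠ n) t, K m t =
      Kernel.deterministic (fun ω => ω ⟨⟨m, Fin.cast (hS m hm) t⟩, hne m hm _⟩)
        (measurable_pi_apply _) := by
    intro m hm t
    simp only [K, Function.update_of_ne hm]
    exact dif_pos hm
  refine ⟨_, inferInstance, ν, K, hν, fun m t => ?_, fun s F hF => ?_⟩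
  · by_cases hm : m = n
    · subst hm
      rw [hKn]
      exact hκ t
    · rw [hKm m hm]
      infer_instance
  set c := measuredCopy hS k s with hc
  have hcn : c n = k n := measuredCopy_self hS k s
  have hF' := measurableSet_copyRectangle c hF
  have hn : copyRectangle c F ⟨n, k n⟩ = F n := by rw [← hcn, copyRectangle_self]
  rw [hP s F hF, h (s n) _ hF', hn]
  -- The event that each site `m ≠ n` reads off an outcome in `F m`; unmeasured copies are
  -- unconstrained.
  set A := Set.univ.pi fun j : {p : (m : Fin N) × Fin (S m) // p ≠ ⟨n, k n⟩} =>
    copyRectangle c F j with hA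
  have hAmeas : MeasurableSet A := .univ_pi fun j => hF' _
  have hmem : ∀ ω, ω ∈ A ↔ ∀ m (hm : m ≠ n),
      ω ⟨⟨m, Fin.cast (hS m hm) (s m)⟩, hne m hm _⟩ ∈ F m := by
    intro ω
    refine ⟨fun hω m hm => ?_, fun hω => ?_⟩
    · have e : copyRectangle c F ⟨m, Fin.cast (hS m hm) (s m)⟩ = F m :=
        if_pos (by rw [hc, measuredCopy_of_ne hS k s hm])
      have h1 : ω ⟨⟨m, Fin.cast (hS m hm) (s m)⟩, hne m hm _⟩ ∈
          copyRectangle c F ⟨m, Fin.cast (hS m hm) (s m)⟩ :=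
        hω ⟨⟨m, Fin.cast (hS m hm) (s m)⟩, hne m hm _⟩ (Set.mem_univ _)
      rwa [e] at h1
    · rintro ⟨⟨m, j⟩, hj⟩ -
      change ω ⟨⟨m, j⟩, hj⟩ ∈ if j = c m then F m else Set.univ
      split_ifs with hjc
      · by_cases hm : m = n
        · subst hm
          refine absurd ?_ hj
          rw [hjc, hcn]
        · rw [hc, measuredCopy_of_ne hS k s hm] at hjc
          subst hjc
          exact hω m hm
      · exact Set.mem_univ _
  -- The deterministic responses multiply to the indicator of `A`, leaving the response of site `n`
  -- integrated over `A`.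
  have hprod : ∀ ω, ∏ m, (K m (s m) ω).real (F m) =
      A.indicator (fun ω => (κ (s n) ω (F n)).toReal) ω := by
    intro ω
    rw [← Finset.mul_prod_erase Finset.univ _ (Finset.mem_univ n), hKn]
    have hm1 : ∀ m (hm : m ≠ n), (K m (s m) ω).real (F m) =
        (F m).indicator 1 (ω ⟨⟨m, Fin.cast (hS m hm) (s m)⟩, hne m hm _⟩) := by
      intro m hm
      rw [hKm m hm, Kernel.deterministic_apply, Measure.real, Measure.dirac_apply' _ (hF m)]
      by_cases hω : ω ⟨⟨m, Fin.cast (hS m hm) (s m)⟩, hne m hm _⟩ ∈ F m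
      · simp [hω]
      · simp [hω]
    by_cases hω : ω ∈ A
    · rw [Set.indicator_of_mem hω, Finset.prod_eq_one, mul_one, Measure.real]
      intro m hm
      rw [hm1 m (Finset.ne_of_mem_erase hm),
        Set.indicator_of_mem ((hmem ω).mp hω m (Finset.ne_of_mem_erase hm)), Pi.one_apply]
    · rw [Set.indicator_of_notMem hω]
      rw [hmem] at hω
      push Not at hω
      obtain ⟨m, hm, hωm⟩ := hω
      rw [Finset.prod_eq_zero (i := m) (by simp [hm]), mul_zero]
      rw [hm1 m hm, Set.indicator_of_notMem hωm]
  rw [integral_congr_ae (ae_of_all _ hprod), integral_indicator hAmeas, integral_toReal]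
  · exact (Kernel.measurable_coe _ (hF n)).aemeasurable
  · exact ae_of_all _ fun ω => (measure_lt_top _ _)

end Model

/-! ### Joint distributions from source operators and from the state itself. -/

section Main

variable {N : ℕ} {H : Fin N → Type u} [∀ n, NormedAddCommGroup (H n)]
  [∀ n, InnerProductSpace ℂ (H n)] [∀ n, CompleteSpace (H n)]
  {ρ : HilbertTensor H →L[ℂ] HilbertTensor H}

/-- A state with a tensor positive source operator admits the LHV description with any number of
settings at one site. -/
theorem IsSourceOperator.admitsLHVDescription (hρ : IsState ρ) {S S' : Fin N → ℕ} {n : Fin N}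
    (hS : ∀ m, m ≠ n → S' m = S m) (k : ∀ m, Fin (S m)) (t₀ : Fin (S' n))
    {T : SourceSpace H S →L[ℂ] SourceSpace H S} (hT : IsSourceOperator ρ S T)
    (hpos : TensorPositive T) : AdmitsLHVDescription.{u, v} ρ S' := by
  intro Λ _ _ M
  have : Nonempty (Fin (S' n)) := ⟨t₀⟩
  -- The source identity with all `X m` equal to the identity gives `tr T = tr ρ`.
  have htr : opTrace T = 1 := by
    have h := hT.opTrace_eq k fun m => ContinuousLinearMap.id ℂ (H m)
    simp only [ite_self] at h
    rwa [tensorOperator_id, tensorOperator_id, ContinuousLinearMap.comp_id,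
      ContinuousLinearMap.comp_id, hρ.opTrace_eq_one] at h
  -- Copy `j` at a site `m ≠ n` carries setting `j`. Copies at site `n` are filled with setting
  -- `t₀`; there only the copy `k n` is ever measured, and `fam` replaces its observable.
  let base (p : (m : Fin N) × Fin (S m)) : POVM (Λ p.1) (H p.1) :=
    if h : p.1 = n then M p.1 (Fin.cast (congrArg S' h.symm) t₀)
    else M p.1 (Fin.cast (hS _ h).symm p.2)
  let fam (t : Fin (S' n)) : ∀ p : (m : Fin N) × Fin (S m), POVM (Λ p.1) (H p.1) :=
    Function.update base ⟨n, k n⟩ (M n t)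
  refine admitsLHVModel_of_multimeasures hS k (μ := fun t => jointDistribution T (fam t))
    (fun t => isMultimeasure_jointDistribution hpos hT.isTraceClass hT.isSelfAdjoint _)
    (fun t => ?_) (fun t t' F hF hFn => ?_) (fun s F hF => ?_)
  · rw [jointDistribution_univ, htr]
    simp
  · have e : (fun p => (fam t p).effect (F p)) = fun p => (fam t' p).effect (F p) := by
      funext p
      by_cases hp : p = ⟨n, k n⟩
      · subst hp
        rw [hFn, POVM.effect_univ, POVM.effect_univ]
      · simp only [fam, Function.update_of_ne hp]
    simp only [jointDistribution, e]
  -- Full sides turn unmeasured copies into identities, so the operator is the one in the defining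
  -- property of a source operator.
  · rw [← opTrace_eq_jointDistribution hpos hT.isTraceClass hT.isSelfAdjoint _
      (measurableSet_copyRectangle _ hF), quantumProbability,
      ← hT.opTrace_eq (measuredCopy hS k s)]
    congr 3
    funext p
    rw [copyRectangle]
    split_ifs with hp
    · obtain ⟨m, j⟩ := p
      dsimp only at hp
      by_cases hm : m = n
      · subst hm
        rw [measuredCopy_self] at hp
        subst hp
        simp only [fam, Function.update_self]
      · rw [measuredCopy_of_ne hS k s hm] at hp
        subst hp
        have hne : (⟨m, Fin.cast (hS m hm) (s m)⟩ : (m : Fin N) × Fin (S m)) ≠ ⟨n, k n⟩ :=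
          fun e => hm (congrArg Sigma.fst e)
        simp only [fam, Function.update_of_ne hne, base, dif_neg hm]
        rfl
    · rw [POVM.effect_univ]

/-- Every state admits the LHV description with one setting at all but one of the sites. -/
theorem IsState.admitsLHVDescription (hρ : IsState ρ) {S' : Fin N → ℕ} {n : Fin N}
    (hS : ∀ m, m ≠ n → S' m = 1) (t₀ : Fin (S' n)) : AdmitsLHVDescription.{u, v} ρ S' := by
  intro Λ _ _ M
  have : Nonempty (Fin (S' n)) := ⟨t₀⟩
  have hpos : TensorPositive ρ := fun ψ => hρ.isPositive.inner_nonneg_right _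
  have hsa := hρ.isPositive.isSelfAdjoint
  let base (m : Fin N) : POVM (Λ m) (H m) :=
    if h : m = n then M m (Fin.cast (congrArg S' h.symm) t₀) else M m (Fin.cast (hS m h).symm 0)
  let fam (t : Fin (S' n)) : ∀ m, POVM (Λ m) (H m) := Function.update base n (M n t)
  -- With one copy per site the pairs `(m, 0)` are just sites. Relabelling rectangles along `e` lets
  -- `ρ` be used directly, without transporting it to another tensor product.
  let e : ((_ : Fin N) × Fin 1) ≃ Fin N := Equiv.sigmaUnique (Fin N) fun _ => Fin 1
  have hpi : ∀ (F : ∀ p : (_ : Fin N) × Fin 1, Set (Λ p.1)) (m : Fin N),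
      Equiv.piCongrLeft (fun m => Set (Λ m)) e F m = F ⟨m, 0⟩ := fun F m =>
    Equiv.piCongrLeft_apply_apply (fun m => Set (Λ m)) e F ⟨m, 0⟩
  refine admitsLHVModel_of_multimeasures (S := fun _ => 1) hS (fun _ => 0)
    (μ := fun t F => jointDistribution ρ (fam t) (Equiv.piCongrLeft (fun m => Set (Λ m)) e F))
    (fun t => (isMultimeasure_jointDistribution hpos hρ.isTraceClass hsa _).comp_piCongrLeft e)
    (fun t => ?_) (fun t t' F hF hFn => ?_) (fun s F hF => ?_)
  · refine (congrArg _ (IsMultimeasure.piCongrLeft_univ e)).trans ?_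
    rw [jointDistribution_univ, hρ.opTrace_eq_one]
    simp
  · simp only [jointDistribution, hpi]
    congr 5
    funext m
    by_cases hm : m = n
    · subst hm
      rw [hFn, POVM.effect_univ, POVM.effect_univ]
    · simp only [fam, Function.update_of_ne hm]
  · have hrect : Equiv.piCongrLeft (fun m => Set (Λ m)) e
        (copyRectangle (S := fun _ => 1) (measuredCopy hS (fun _ => 0) s) F) = F := by
      funext m
      rw [hpi, copyRectangle, if_pos (Subsingleton.elim _ _)]
    rw [hrect, ← opTrace_eq_jointDistribution hpos hρ.isTraceClass hsa _ hF, quantumProbability]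
    congr 3
    funext m
    by_cases hm : m = n
    · subst hm
      simp only [fam, Function.update_self]
    · have := hS m hm
      have hs : s m = Fin.cast (hS m hm).symm 0 := by
        ext
        have := (s m).2
        simp
        omega
      simp only [fam, Function.update_of_ne hm, base, dif_neg hm, hs]

end Main

theorem proposition5 {N : ℕ} {H : Fin N → Type u} [∀ n, NormedAddCommGroup (H n)]
    [∀ n, InnerProductSpace ℂ (H n)] [∀ n, CompleteSpace (H n)]
    [∀ n, TopologicalSpace.SeparableSpace (H n)]
    (ρ : HilbertTensor H →L[ℂ] HilbertTensor H) (hρ : IsState ρ) :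
    (∀ (n : Fin N) (Sn : ℕ), 1 ≤ Sn →
      AdmitsLHVDescription.{u, v} ρ (Function.update (fun _ => 1) n Sn)) ∧
    (∀ (S : Fin N → ℕ), (∀ m, 1 ≤ S m) → ∀ n : Fin N, S n = 1 →
      (∃ T : SourceSpace H S →L[ℂ] SourceSpace H S,
        IsSourceOperator ρ S T ∧ TensorPositive T) →
      ∀ S' : ℕ, 1 ≤ S' → AdmitsLHVDescription.{u, v} ρ (Function.update S n S')) ∧
    (∀ (S : Fin N → ℕ), (∀ m, 1 ≤ S m) →
      (∃ T : SourceSpace H S →L[ℂ] SourceSpace H S,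
        IsSourceOperator ρ S T ∧ TensorPositive T) →
      ∀ (n : Fin N) (S' : ℕ), 1 ≤ S' →
        AdmitsLHVDescription.{u, v} ρ (Function.update S n S')) := by
  have hupd : ∀ (S : Fin N → ℕ) (n : Fin N) (S' : ℕ), ∀ m, m ≠ n →
      Function.update S n S' m = S m := fun S n S' m hm => Function.update_of_ne hm _ _
  have hc : ∀ S : Fin N → ℕ, (∀ m, 1 ≤ S m) →
      (∃ T : SourceSpace H S →L[ℂ] SourceSpace H S,
        IsSourceOperator ρ S T ∧ TensorPositive T) →
      ∀ (n : Fin N) (S' : ℕ), 1 ≤ S' →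
        AdmitsLHVDescription.{u, v} ρ (Function.update S n S') := by
    rintro S hS ⟨T, hT, hpos⟩ n S' hS'
    exact hT.admitsLHVDescription hρ (hupd S n S') (fun m => ⟨0, hS m⟩)
      ⟨0, by rwa [Function.update_self]⟩ hpos
  -- The second claim is the third one at the given site.
  exact ⟨fun n Sn hSn => hρ.admitsLHVDescription (n := n) (hupd _ n Sn)
      ⟨0, by rwa [Function.update_self]⟩,
    fun S hS n _ hT S' hS' => hc S hS hT n S' hS', hc⟩
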